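/- All vector spaces are complex, scalar products are linear in the first argument, and $I,J$ are countable index sets. **Sequence spaces.** For a weight $w=(w_i)_{i\in I}$, $w_i>0$, and $1\le p\le\infty$, let $\ell^p_w(I)=\{c:\ \|c\|_{\ell^p_w}:=\|(c_iw_i)_i\|_{\ell^p}<\infty\}$. Let $\ell^{1,1}_{w_1\otimes w_2}(I\times J)$ be the space of all $c:I\times J\to\mathbb C$ with $\|c\|=\sum_{j}\sum_{i}|c_{i,j}|\,w_{1,i}w_{2,j}<\infty$. **Algebras and weights.** A *spectral matrix algebra* $\mathcal A$ over $I$ is an involutive Banach algebra of complex $I\times I$-matrices (with the matrix product, the involution $A\mapsto A^*$, and the identity matrix as its unit) such that (i) every $A\in\mathcal A$ defines a bounded operator on $\ell^2(I)$; (ii) if $A\in\mathcal A$ is invertible in $B(\ell^2(I))$, then $A^{-1}\in\mathcal A$; (iii) if $A\in\mathcal A$ and $|b_{i,j}|\le|a_{i,j}|$ for all $i,j$, then $B\in\mathcal A$ and $\|B\|_{\mathcal A}\le\|A\|_{\mathcal A}$. A weight $w$ is *$\mathcal A$-admissible* if every $A\in\mathcal A$ defines a bounded operator on $\ell^p_w(I)$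 for every $1\le p\le\infty$. **Localised frames.** A frame $\Psi=(\psi_i)_{i\in I}$ for a Hilbert space $\mathcal H$ is *$\mathcal A$-localised* if its Gram matrix $(\langle\psi_{i'},\psi_i\rangle)_{i,i'}$ belongs to $\mathcal A$. Its canonical dual frame is $\widetilde\Psi=(S^{-1}\psi_i)_i$, where $Sf=\sum_i\langle f,\psi_i\rangle\psi_i$, and $C_{\widetilde\Psi}f=(\langle f,\widetilde\psi_i\rangle)_i$. **Co-orbit spaces.** Let $\mathcal H_{00}(\Psi)$ be the linear span of $\{\psi_i\}$. The space $\mathcal H^1_w(\Psi)$ is the completion of $\mathcal H_{00}(\Psi)$ in the norm $\|C_{\widetilde\Psi}f\|_{\ell^1_w(I)}$. For $f_1\in\mathcal H_1$, $f_2\in\mathcal H_2$ let $f_1\otimes f_2$ be the rank one operator $f\mapsto\langle f,f_1\rangle f_2$; it is conjugate linear in $f_1$. Let $\mathcal H_1\otimes\mathcal H_2$ be the Hilbert space completion of the span of these for $\langle f_1\otimes f_2,g_1\otimes g_2\rangle=\overline{\langle f_1,g_1\rangle}\langle f_2,g_2\rangle$. For frames $\Psi_1=(\psi_{1,i})_{i\in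 I}$ of $\mathcal H_1$ and $\Psi_2=(\psi_{2,j})_{j\in J}$ of $\mathcal H_2$, the space $\mathcal H^{1,1}_{w_1\otimes w_2}(\Psi_1\otimes\Psi_2)$ is the completion of the linear span $\mathcal H_{00}(\Psi_1\otimes\Psi_2)$ of the frame $\Psi_1\otimes\Psi_2=(\psi_{1,i}\otimes\psi_{2,j})_{(i,j)}$ of $\mathcal H_1\otimes\mathcal H_2$ in the norm $\|C_{\widetilde{\Psi_1\otimes\Psi_2}}F\|_{\ell^{1,1}_{w_1\otimes w_2}(I\times J)}$. **Projective tensor product.** $B_1\widehat\otimes_\pi B_2$ is the completion of the algebraic tensor product of the Banach spaces $B_1$ and $B_2$ in the norm $\inf\sum_r\|f_r\|_{B_1}\|g_r\|_{B_2}$, the infimum being over all representations $\sum_r f_r\otimes g_r$. In accordance with the convention above, $f\otimes g$ is here taken to be conjugate linear in $f$ and linear in $g$. **Theorem (tensor product property).** For $n=1,2$ let $\mathcal H_n$ be a Hilbert space, $\mathcal A_n$ a spectral matrix algebra (over $I$ for $n=1$, over $J$ for $n=2$), $\Psi_n\subset\mathcal H_n$ an $\mathcal A_n$-localised frame, and $w_n$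 an $\mathcal A_n$-admissible weight. Then the expressions above are (finite) norms on $\mathcal H_{00}(\Psi_1)$, $\mathcal H_{00}(\Psi_2)$ and $\mathcal H_{00}(\Psi_1\otimes\Psi_2)$, and $$\mathcal H^{1,1}_{w_1\otimes w_2}(\Psi_1\otimes\Psi_2)=\mathcal H^1_{w_1}(\Psi_1)\,\widehat\otimes_\pi\,\mathcal H^1_{w_2}(\Psi_2)$$ with equivalent norms. That is, there are a linear bijection $\Phi$ from the right-hand side onto the left-hand side and a constant $C\ge1$ such that $\Phi(f\otimes g)=f\otimes g\in\mathcal H_{00}(\Psi_1\otimes\Psi_2)$ for all $f\in\mathcal H_{00}(\Psi_1)$, $g\in\mathcal H_{00}(\Psi_2)$, and $C^{-1}\|T\|\le\|\Phi T\|\le C\|T\|$ for all $T$. -/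

import Mathlib

open scoped TensorProduct

noncomputable section

namespace LocalisedFrames

/-! ### Infinite matrices and weighted sequence spaces -/

section Matrices

variable {I : Type*}

/-- The sequence `c · w`. A sequence `c` lies in `ℓ^p_w(I)` iff `c · w` lies in `ℓ^p(I)`, and its
`ℓ^p_w`-norm is the `ℓ^p`-norm of `c · w`. -/
def weighted (w : I → ℝ) (c : I → ℂ) : I → ℂ := fun i => (w i : ℂ) * c i

/-- The action of an infinite matrix on a sequence. -/
def matVec (a : Matrix I I ℂ) (c : I → ℂ) : I → ℂ := fun i => ∑' j, a i j * c j

/-- The product of two infinite matrices. -/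
def matMul (a b : Matrix I I ℂ) : Matrix I I ℂ := fun i j => ∑' k, a i k * b k j

open Classical in
/-- The identity matrix. -/
def matOne : Matrix I I ℂ := fun i j => if i = j then 1 else 0

/-- The matrix `a` defines a bounded operator on `ℓ^p_w(I)`: for each `c ∈ ℓ^p_w(I)` the sums
`∑_j a_{ij} c_j` converge, and they form a sequence in `ℓ^p_w(I)` of norm at most `C ‖c‖`. -/
def ActsBoundedly (a : Matrix I I ℂ) (p : ENNReal) (w : I → ℝ) : Prop :=
  ∃ C : ℝ, ∀ (c : I → ℂ) (hc : Memℓp (weighted w c) p),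
    (∀ i, Summable fun j => a i j * c j) ∧
    ∃ h : Memℓp (weighted w (matVec a c)) p,
      ‖(⟨weighted w (matVec a c), h⟩ : lp (fun _ : I => ℂ) p)‖ ≤
        C * ‖(⟨weighted w c, hc⟩ : lp (fun _ : I => ℂ) p)‖

/-- Spectral matrix algebras: unital Banach algebras of infinite matrices, closed under the
involution `a ↦ a^*` (which may, but need not, be isometric), that consist of matrices bounded on
`ℓ²(I)`, are inverse-closed in `B(ℓ²(I))`, and are solid. The function `norm` is only relevant on
`carrier`. -/
structure SpectralMatrixAlgebra (I : Type*) where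
  /-- the matrices of the algebra, a vector space -/
  carrier : Submodule ℂ (Matrix I I ℂ)
  /-- the norm of the algebra -/
  norm : Matrix I I ℂ → ℝ
  norm_eq_zero_iff : ∀ a ∈ carrier, norm a = 0 ↔ a = 0
  norm_nonneg : ∀ a ∈ carrier, 0 ≤ norm a
  norm_add_le : ∀ a ∈ carrier, ∀ b ∈ carrier, norm (a + b) ≤ norm a + norm b
  norm_smul : ∀ (z : ℂ), ∀ a ∈ carrier, norm (z • a) = ‖z‖ * norm a
  complete : ∀ u : ℕ → Matrix I I ℂ, (∀ n, u n ∈ carrier) →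
    (∀ ε > 0, ∃ N, ∀ m ≥ N, ∀ n ≥ N, norm (u m - u n) < ε) →
    ∃ a ∈ carrier, ∀ ε > 0, ∃ N, ∀ n ≥ N, norm (u n - a) < ε
  one_mem : matOne ∈ carrier
  mul_mem : ∀ a ∈ carrier, ∀ b ∈ carrier, matMul a b ∈ carrier
  norm_mul_le : ∀ a ∈ carrier, ∀ b ∈ carrier, norm (matMul a b) ≤ norm a * norm b
  conjTranspose_mem : ∀ a ∈ carrier, a.conjTranspose ∈ carrier
  bounded : ∀ a ∈ carrier, ActsBoundedly a 2 (fun _ => 1)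
  inverse_closed : ∀ a ∈ carrier, ∀ b : Matrix I I ℂ, ActsBoundedly b 2 (fun _ => 1) →
    matMul a b = matOne → matMul b a = matOne → b ∈ carrier
  solid : ∀ a ∈ carrier, ∀ b : Matrix I I ℂ, (∀ i j, ‖b i j‖ ≤ ‖a i j‖) →
    b ∈ carrier ∧ norm b ≤ norm a

/-- `𝒜`-admissible weights. -/
structure SpectralMatrixAlgebra.IsAdmissible (𝒜 : SpectralMatrixAlgebra I) (w : I → ℝ) :
    Prop where
  pos : ∀ i, 0 < w i
  bounded : ∀ a ∈ 𝒜.carrier, ∀ p : ENNReal, 1 ≤ p → ActsBoundedly a p w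

end Matrices

/-! ### Frames and their co-orbit spaces -/

section Frames

variable {I H : Type*} [NormedAddCommGroup H] [InnerProductSpace ℂ H]

/-- Mathlib's `inner ℂ x y` is conjugate linear in `x`, so that the scalar product `⟨f, g⟩`, linear
in `f`, is `inner ℂ g f`. -/
def IsFrame (ψ : I → H) : Prop :=
  ∃ A B : ℝ, 0 < A ∧ 0 < B ∧ ∀ f : H,
    Summable (fun i => ‖inner ℂ (ψ i) f‖ ^ 2) ∧
    A * ‖f‖ ^ 2 ≤ ∑' i, ‖inner ℂ (ψ i) f‖ ^ 2 ∧
    ∑' i, ‖inner ℂ (ψ i) f‖ ^ 2 ≤ B * ‖f‖ ^ 2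

/-- `𝒜`-localised frames: the Gram matrix `(⟨ψ_{i'}, ψ_i⟩)_{i,i'}` belongs to `𝒜`. -/
structure SpectralMatrixAlgebra.IsLocalised (𝒜 : SpectralMatrixAlgebra I) (ψ : I → H) :
    Prop where
  isFrame : IsFrame ψ
  gram_mem : Matrix.gram ℂ ψ ∈ 𝒜.carrier

/-- The frame operator `S f = ∑_i ⟨f, ψ_i⟩ ψ_i`. -/
def frameOperator (ψ : I → H) (f : H) : H := ∑' i, inner ℂ (ψ i) f • ψ i

/-- The canonical dual frame `S⁻¹ ψ_i` (the frame operator of a frame is bijective, and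
`Function.invFun` is then its inverse). -/
def canonicalDual (ψ : I → H) (i : I) : H := Function.invFun (frameOperator ψ) (ψ i)

/-- The analysis operator `C_φ f = (⟨f, φ_i⟩)_i`. -/
def analysis (φ : I → H) : H →ₗ[ℂ] (I → ℂ) where
  toFun f := fun i => inner ℂ (φ i) f
  map_add' f g := by ext i; simp
  map_smul' z f := by ext i; simp

/-- The sequence `C_{ψ~} f · w`, where `ψ~` is the canonical dual of `ψ`. -/
def weightedCoeff (ψ : I → H) (w : I → ℝ) : H →ₗ[ℂ] (I → ℂ) where
  toFun f := weighted w (analysis (canonicalDual ψ) f)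
  map_add' f g := by ext i; simp [weighted, mul_add]
  map_smul' z f := by ext i; simp [weighted, mul_left_comm]

/-- The space `H_00(ψ)` of finite linear combinations of the `ψ_i`. -/
def H00 (ψ : I → H) : Submodule ℂ H := Submodule.span ℂ (Set.range ψ)

/-- `‖C_{ψ~} f‖_{ℓ^1_w}` is a norm on `H_00(ψ)`: it is finite, and zero only for `f = 0`. -/
def CoorbitNormWellDefined (ψ : I → H) (w : I → ℝ) : Prop :=
  ∀ f ∈ H00 ψ, Memℓp (weightedCoeff ψ w f) 1 ∧ (weightedCoeff ψ w f = 0 → f = 0)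

/-- The elements `f` of `H_00(ψ)` with `‖C_{ψ~} f‖_{ℓ^1_w} < ∞`. If `CoorbitNormWellDefined ψ w`
holds then this is all of `H_00(ψ)`. -/
def preCoorbitSubmodule (ψ : I → H) (w : I → ℝ) : Submodule ℂ H where
  carrier := {f | f ∈ H00 ψ ∧ Memℓp (weightedCoeff ψ w f) 1}
  zero_mem' := ⟨zero_mem _, by rw [map_zero]; exact zero_memℓp⟩
  add_mem' hf hg := ⟨add_mem hf.1 hg.1, by rw [map_add]; exact hf.2.add hg.2⟩
  smul_mem' z _ hf := ⟨Submodule.smul_mem _ z hf.1, by rw [map_smul]; exact hf.2.const_smul z⟩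

/-- `preCoorbitSubmodule ψ w` as a type, normed by `‖C_{ψ~} f‖_{ℓ^1_w}` and not by the norm
of `H`. -/
def PreCoorbit (ψ : I → H) (w : I → ℝ) : Type _ := preCoorbitSubmodule ψ w

instance (ψ : I → H) (w : I → ℝ) : AddCommGroup (PreCoorbit ψ w) :=
  inferInstanceAs (AddCommGroup (preCoorbitSubmodule ψ w))

instance (ψ : I → H) (w : I → ℝ) : Module ℂ (PreCoorbit ψ w) :=
  inferInstanceAs (Module ℂ (preCoorbitSubmodule ψ w))

/-- The underlying vector of `H`. -/
def PreCoorbit.val {ψ : I → H} {w : I → ℝ} : PreCoorbit ψ w →ₗ[ℂ] H :=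
  (preCoorbitSubmodule ψ w).subtype

/-- The map `f ↦ C_{ψ~} f · w` into `ℓ^1(I)`. -/
def PreCoorbit.toLp (ψ : I → H) (w : I → ℝ) : PreCoorbit ψ w →ₗ[ℂ] lp (fun _ : I => ℂ) 1 where
  toFun f := ⟨weightedCoeff ψ w f.1, f.2.2⟩
  map_add' f g := Subtype.ext (map_add (weightedCoeff ψ w) f.1 g.1)
  map_smul' z f := Subtype.ext (map_smul (weightedCoeff ψ w) z f.1)

/-- The norm `‖f‖ = ‖C_{ψ~} f‖_{ℓ^1_w}`. -/
instance (ψ : I → H) (w : I → ℝ) : SeminormedAddCommGroup (PreCoorbit ψ w) :=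
  SeminormedAddCommGroup.induced _ _ (PreCoorbit.toLp ψ w)

instance (ψ : I → H) (w : I → ℝ) : NormedSpace ℂ (PreCoorbit ψ w) :=
  NormedSpace.induced ℂ _ _ (PreCoorbit.toLp ψ w)

/-- The co-orbit space `H^1_w(ψ)`: the completion of `H_00(ψ)` in the norm
`‖C_{ψ~} f‖_{ℓ^1_w}`. -/
abbrev Coorbit (ψ : I → H) (w : I → ℝ) : Type _ := UniformSpace.Completion (PreCoorbit ψ w)

end Frames

/-! ### Complex conjugate spaces -/

/-- The complex conjugate of a complex vector space: the same additive group (and norm), with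
scalar multiplication `(z, x) ↦ z̄ x`. -/
def Conj (E : Type*) : Type _ := E

/-- The identity as a map from `E` to its conjugate; it is conjugate linear. -/
def toConj {E : Type*} (x : E) : Conj E := x

/-- The identity as a map from the conjugate of `E` to `E`. -/
def ofConj {E : Type*} (x : Conj E) : E := x

section Conj

variable {E : Type*}

instance [NormedAddCommGroup E] : NormedAddCommGroup (Conj E) :=
  inferInstanceAs (NormedAddCommGroup E)

instance [NormedAddCommGroup E] [NormedSpace ℂ E] : Module ℂ (Conj E) :=
  Module.compHom E (starRingEnd ℂ)

theorem smul_toConj [NormedAddCommGroup E] [NormedSpace ℂ E] (z : ℂ) (x : E) :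
    z • toConj x = toConj (starRingEnd ℂ z • x) := rfl

instance [NormedAddCommGroup E] [NormedSpace ℂ E] : NormedSpace ℂ (Conj E) where
  norm_smul_le z x := by
    have h : ‖starRingEnd ℂ z • ofConj x‖ ≤ ‖z‖ * ‖ofConj x‖ := by
      rw [norm_smul, RCLike.norm_conj]
    exact h

instance [NormedAddCommGroup E] [InnerProductSpace ℂ E] : InnerProductSpace ℂ (Conj E) where
  inner x y := inner ℂ (ofConj y) (ofConj x)
  norm_sq_eq_re_inner x := norm_sq_eq_re_inner (𝕜 := ℂ) (ofConj x)
  conj_inner_symm x y := inner_conj_symm (𝕜 := ℂ) (ofConj y) (ofConj x)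
  add_left x y z := inner_add_right (𝕜 := ℂ) (ofConj z) (ofConj x) (ofConj y)
  smul_left x y z := inner_smul_right (𝕜 := ℂ) (ofConj y) (ofConj x) (starRingEnd ℂ z)

theorem inner_toConj [NormedAddCommGroup E] [InnerProductSpace ℂ E] (x y : E) :
    inner ℂ (toConj x) (toConj y) = inner ℂ y x := rfl

end Conj

/-! ### The tensor product of two Hilbert spaces -/

section HilbertTensor

variable {I J H₁ H₂ : Type*} [NormedAddCommGroup H₁] [InnerProductSpace ℂ H₁]
  [NormedAddCommGroup H₂] [InnerProductSpace ℂ H₂]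

variable (H₁ H₂) in
/-- The Hilbert space `H₁ ⊗ H₂`: the completion of the span of the simple tensors `f₁ ⊗ f₂`, which
are conjugate linear in `f₁`, for the inner product
`⟨f₁ ⊗ f₂, g₁ ⊗ g₂⟩ = conj ⟨f₁, g₁⟩ ⟨f₂, g₂⟩`. The simple tensor `f₁ ⊗ f₂` corresponds to
the Hilbert-Schmidt operator `f ↦ ⟨f, f₁⟩ f₂`. -/
abbrev HilbertTensor : Type _ := UniformSpace.Completion (Conj H₁ ⊗[ℂ] H₂)

/-- The simple tensor `f₁ ⊗ f₂`. -/
def simpleTensor (f₁ : H₁) (f₂ : H₂) : HilbertTensor H₁ H₂ :=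
  ((toConj f₁ ⊗ₜ[ℂ] f₂ : Conj H₁ ⊗[ℂ] H₂) : UniformSpace.Completion (Conj H₁ ⊗[ℂ] H₂))

theorem inner_simpleTensor (f₁ g₁ : H₁) (f₂ g₂ : H₂) :
    inner ℂ (simpleTensor f₁ f₂) (simpleTensor g₁ g₂) =
      starRingEnd ℂ (inner ℂ f₁ g₁) * inner ℂ f₂ g₂ := by
  simp [simpleTensor, UniformSpace.Completion.inner_coe, inner_toConj]

/-- The family `ψ₁ ⊗ ψ₂ = (ψ_{1,i} ⊗ ψ_{2,j})_{(i,j)}`. -/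
def tensorFrame (ψ₁ : I → H₁) (ψ₂ : J → H₂) : I × J → HilbertTensor H₁ H₂ :=
  fun ij => simpleTensor (ψ₁ ij.1) (ψ₂ ij.2)

/-- The weight `w₁ ⊗ w₂ = (w_{1,i} w_{2,j})_{(i,j)}`. -/
def tensorWeight (w₁ : I → ℝ) (w₂ : J → ℝ) : I × J → ℝ := fun ij => w₁ ij.1 * w₂ ij.2

/-- The co-orbit space `H^{1,1}_{w₁ ⊗ w₂}(ψ₁ ⊗ ψ₂)`: the completion of `H_00(ψ₁ ⊗ ψ₂)` in the norm
`‖C_{(ψ₁ ⊗ ψ₂)~} F‖` of `ℓ^{1,1}_{w₁ ⊗ w₂}(I × J)`. The norm of the latter,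
`∑_j ∑_i |c_{ij}| w_{1,i} w_{2,j}`, is that of `ℓ^1_{w₁ ⊗ w₂}(I × J)`. -/
abbrev TensorCoorbit (ψ₁ : I → H₁) (ψ₂ : J → H₂) (w₁ : I → ℝ) (w₂ : J → ℝ) : Type _ :=
  Coorbit (tensorFrame ψ₁ ψ₂) (tensorWeight w₁ w₂)

end HilbertTensor

/-! ### The projective tensor product of two Banach spaces -/

section Projective

variable (E F : Type*) [NormedAddCommGroup E] [NormedSpace ℂ E]
  [NormedAddCommGroup F] [NormedSpace ℂ F]

/-- The algebraic tensor product, to be equipped with the projective norm. -/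
def PreProj : Type _ := E ⊗[ℂ] F

instance : AddCommGroup (PreProj E F) := inferInstanceAs (AddCommGroup (E ⊗[ℂ] F))

instance : Module ℂ (PreProj E F) := inferInstanceAs (Module ℂ (E ⊗[ℂ] F))

variable {E F}

/-- The simple tensors in the algebraic tensor product. -/
def PreProj.tmul (x : E) (y : F) : PreProj E F := x ⊗ₜ[ℂ] y

theorem PreProj.smul_tmul' (z : ℂ) (x : E) (y : F) :
    z • PreProj.tmul x y = PreProj.tmul (z • x) y := rfl

/-- The element `∑_r x_r ⊗ y_r`. -/
def PreProj.sumTmul (l : List (E × F)) : PreProj E F := (l.map fun q => tmul q.1 q.2).sum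

/-- The number `∑_r ‖x_r‖ ‖y_r‖`. -/
def PreProj.cost (l : List (E × F)) : ℝ := (l.map fun q => ‖q.1‖ * ‖q.2‖).sum

theorem PreProj.cost_nonneg (l : List (E × F)) : 0 ≤ cost l :=
  List.sum_nonneg (by simp only [List.mem_map]; rintro _ ⟨q, -, rfl⟩; positivity)

theorem PreProj.exists_sumTmul (t : PreProj E F) : ∃ l : List (E × F), sumTmul l = t := by
  refine TensorProduct.induction_on (motive := fun t => ∃ l : List (E × F), sumTmul l = t) t
    ⟨[], rfl⟩ (fun x y => ⟨[(x, y)], add_zero (tmul x y)⟩) ?_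
  · rintro s t ⟨l, rfl⟩ ⟨m, rfl⟩
    exact ⟨l ++ m, by simp only [sumTmul, List.map_append, List.sum_append]; rfl⟩

/-- The projective norm: the infimum of `∑_r ‖x_r‖ ‖y_r‖` over all representations
`t = ∑_r x_r ⊗ y_r`. -/
def PreProj.projNorm (t : PreProj E F) : ℝ :=
  ⨅ l : {l : List (E × F) // sumTmul l = t}, cost l.1

theorem PreProj.projNorm_le {t : PreProj E F} {l : List (E × F)} (h : sumTmul l = t) :
    projNorm t ≤ cost l :=
  ciInf_le (f := fun l : {l : List (E × F) // sumTmul l = t} => cost l.1)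
    ⟨0, by rintro _ ⟨l, rfl⟩; exact cost_nonneg l.1⟩ ⟨l, h⟩

theorem PreProj.le_projNorm {t : PreProj E F} {r : ℝ}
    (h : ∀ l : List (E × F), sumTmul l = t → r ≤ cost l) : r ≤ projNorm t := by
  obtain ⟨l, hl⟩ := exists_sumTmul t
  have : Nonempty {l : List (E × F) // sumTmul l = t} := ⟨⟨l, hl⟩⟩
  exact le_ciInf fun l => h l.1 l.2

theorem PreProj.projNorm_zero : projNorm (0 : PreProj E F) = 0 :=
  le_antisymm (projNorm_le (l := []) rfl) (le_projNorm fun l _ => cost_nonneg l)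

theorem PreProj.projNorm_add_le (s t : PreProj E F) :
    projNorm (s + t) ≤ projNorm s + projNorm t := by
  rw [← sub_le_iff_le_add]
  refine le_projNorm fun l hl => ?_
  rw [sub_le_comm]
  refine le_projNorm fun m hm => ?_
  rw [sub_le_iff_le_add]
  refine (projNorm_le (l := l ++ m) ?_).trans ?_
  · simp only [sumTmul, List.map_append, List.sum_append] at hl hm ⊢
    rw [hl, hm]
  · simp [cost, add_comm]

theorem PreProj.projNorm_smul_le (z : ℂ) (t : PreProj E F) :
    projNorm (z • t) ≤ ‖z‖ * projNorm t := by
  rcases eq_or_ne z 0 with rfl | hz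
  · simp [projNorm_zero]
  · have hz' : 0 < ‖z‖ := norm_pos_iff.mpr hz
    rw [← div_le_iff₀' hz']
    refine le_projNorm fun l hl => ?_
    rw [div_le_iff₀' hz']
    refine (projNorm_le (l := l.map fun q => (z • q.1, q.2)) ?_).trans (le_of_eq ?_)
    · rw [← hl]
      simp only [sumTmul, List.smul_sum, List.map_map]
      rfl
    · simp only [cost, List.map_map, Function.comp_def, norm_smul, mul_assoc]
      rw [List.sum_map_mul_left]

/-- The projective norm as a seminorm. -/
def PreProj.projSeminorm : Seminorm ℂ (PreProj E F) :=
  Seminorm.ofSMulLE projNorm projNorm_zero projNorm_add_le projNorm_smul_le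

instance : SeminormedAddCommGroup (PreProj E F) :=
  (PreProj.projSeminorm (E := E) (F := F)).toAddGroupSeminorm.toSeminormedAddCommGroup

instance : NormedSpace ℂ (PreProj E F) where
  norm_smul_le := PreProj.projNorm_smul_le

variable (E F) in
/-- The projective tensor product of `E` and `F`: the completion of the algebraic tensor product
in the projective norm. -/
abbrev ProjTensor : Type _ := UniformSpace.Completion (PreProj E F)

/-- The simple tensor `x ⊗ y` in the projective tensor product. -/
def ProjTensor.tmul (x : E) (y : F) : ProjTensor E F :=
  ((PreProj.tmul x y : PreProj E F) : UniformSpace.Completion (PreProj E F))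

end Projective

end LocalisedFrames

end

open LocalisedFrames

/-!
The theorem rests on two facts: the projective tensor product of two weighted `ℓ^1`-spaces is the
`ℓ^1`-space of the product weight, and the co-orbit spaces are well-behaved subspaces of
`ℓ^1`-spaces. Neither is used as such; both enter through atomic decompositions.

*Atomic decompositions.* Let `P` be the matrix `(⟨ψ_{i'}, ψ~_i⟩)_{i,i'}`. If its `i'`-th column has
norm at most `K w_{i'}` in `ℓ^1_w` (`IsAtomic`), then `‖ψ_i‖ ≤ K w_i` in the co-orbit norm, so that
that norm is finite on `H_00(ψ)` and the series `f = ∑_i ⟨f, ψ~_i⟩ ψ_i` converges absolutely in it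
(`IsAtomic.hasSum_atom`). Consequently, for each family `a` in a Banach space with `‖a_i‖ ≤ K' w_i`,
the map `f ↦ ∑_i ⟨f, ψ~_i⟩ a_i` is bounded on the co-orbit space (`IsAtomic.synthesis`).

*Localised frames are atomic.* An admissible weight bounds the columns of every matrix in `𝒜`, so it
is enough that `P` belongs to `𝒜` (`SpectralMatrixAlgebra.IsLocalised.crossGram_mem`). With the
analysis operator `C` of the frame, `C C^*` has the Gram matrix as its matrix, `S = C^* C` is
invertible, and `P` is the matrix of the orthogonal projection `C S⁻¹ C^*` onto the range of `C`.
For small `z ≠ 0` the resolvent of `C C^*` is `z⁻¹ (1 - C S⁻¹ C^*) + C S⁻¹ (z - S)⁻¹ C^*`, where the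
second term is holomorphic at `0`. As `𝒜` is inverse-closed, these resolvents have their matrices
in `𝒜`, and their Riesz integral over a small circle around `0` can be formed in the Banach algebra
`𝒜`. Solidity makes the matrix entries continuous on `𝒜`, which identifies the integral as the
matrix of `1 - C S⁻¹ C^*` (`opMatrix_mem_of_resolvent`).

*The tensor product.* The family `ψ₁ ⊗ ψ₂` is a frame with frame operator `S₁ ⊗ S₂` and canonical
dual `ψ₁~ ⊗ ψ₂~` (`IsFrame.tensor`, `IsFrame.inner_canonicalDual_tensorFrame`). Hence the co-orbit
norm of `f ⊗ g` is the product of those of `f` and `g`, so that `ψ₁ ⊗ ψ₂` is atomic as well, and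
`(f, g) ↦ f ⊗ g` extends to a bounded map from the projective tensor product
(`projToCoorbit`). Its inverse is `F ↦ ∑_{i,j} ⟨F, ψ₁~_i ⊗ ψ₂~_j⟩ ψ_{1,i} ⊗ ψ_{2,j}`, the sum being
taken in the projective tensor product (`coorbitToProj`). That the two maps are inverse to each
other is the atomic decomposition of `F`, respectively of `f` and `g`.
-/

noncomputable section

namespace LocalisedFrames

/-! ### Matrices of bounded operators on `ℓ²` -/

section OperatorMatrices

variable {I : Type*}

open Classical in
/-- The matrix of a bounded operator on `ℓ²(I)` in the standard basis. -/
def opMatrix : (lp (fun _ : I => ℂ) 2 →L[ℂ] lp (fun _ : I => ℂ) 2) →ₗ[ℂ] Matrix I I ℂ where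
  toFun T := fun i j => T (lp.single 2 j 1) i
  map_add' _ _ := rfl
  map_smul' _ _ := rfl

open Classical in
theorem opMatrix_apply (T : lp (fun _ : I => ℂ) 2 →L[ℂ] lp (fun _ : I => ℂ) 2) (i j : I) :
    opMatrix T i j = T (lp.single 2 j 1) i := rfl

open Classical in
/-- A continuous linear map on `ℓ^p`, `p < ∞`, is determined by its values at the unit vectors. -/
theorem hasSum_map_single {E : Type*} [NormedAddCommGroup E] [NormedSpace ℂ E]
    {p : ENNReal} [Fact (1 ≤ p)] (hp : p ≠ ⊤)
    (T : lp (fun _ : I => ℂ) p →L[ℂ] E) (c : lp (fun _ : I => ℂ) p) :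
    HasSum (fun k => c k • T (lp.single p k 1)) (T c) := by
  convert (lp.hasSum_single hp c).mapL T using 2 with k
  rw [← map_smul, ← lp.single_smul, smul_eq_mul, mul_one]

theorem hasSum_opMatrix (T : lp (fun _ : I => ℂ) 2 →L[ℂ] lp (fun _ : I => ℂ) 2)
    (c : lp (fun _ : I => ℂ) 2) (i : I) : HasSum (fun k => opMatrix T i k * c k) (T c i) := by
  simp only [mul_comm (opMatrix T i _)]
  exact hasSum_map_single (by simp) ((lp.evalCLM ℂ (fun _ : I => ℂ) 2 i).comp T) c

theorem opMatrix_mul (S T : lp (fun _ : I => ℂ) 2 →L[ℂ] lp (fun _ : I => ℂ) 2) :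
    opMatrix (S * T) = matMul (opMatrix S) (opMatrix T) := by
  ext i j
  exact (hasSum_opMatrix S _ i).tsum_eq.symm

theorem opMatrix_one :
    opMatrix (1 : lp (fun _ : I => ℂ) 2 →L[ℂ] lp (fun _ : I => ℂ) 2) = matOne := by
  classical
  ext i j
  simp [opMatrix_apply, matOne, Pi.single_apply]

theorem opMatrix_injective : Function.Injective (opMatrix (I := I)) := by
  intro S T h
  ext c i
  refine (hasSum_opMatrix S c i).unique ?_
  rw [h]
  exact hasSum_opMatrix T c i

theorem weighted_one (c : I → ℂ) : weighted (fun _ => 1) c = c := by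
  ext i
  simp [weighted]

theorem actsBoundedly_opMatrix (T : lp (fun _ : I => ℂ) 2 →L[ℂ] lp (fun _ : I => ℂ) 2) :
    ActsBoundedly (opMatrix T) 2 (fun _ => 1) := by
  refine ⟨‖T‖, fun c hc => ?_⟩
  have hc' : Memℓp c 2 := by rwa [weighted_one] at hc
  have h : weighted (fun _ => 1) (matVec (opMatrix T) c) = T ⟨c, hc'⟩ := by
    rw [weighted_one]
    ext i
    exact (hasSum_opMatrix T ⟨c, hc'⟩ i).tsum_eq
  refine ⟨fun i => (hasSum_opMatrix T ⟨c, hc'⟩ i).summable, h ▸ lp.memℓp _, ?_⟩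
  have h1 : (⟨weighted (fun _ => 1) (matVec (opMatrix T) c), h ▸ lp.memℓp _⟩ :
      lp (fun _ : I => ℂ) 2) = T ⟨c, hc'⟩ := Subtype.ext h
  have h2 : (⟨weighted (fun _ => 1) c, hc⟩ : lp (fun _ : I => ℂ) 2) = ⟨c, hc'⟩ :=
    Subtype.ext (weighted_one c)
  rw [h1, h2]
  exact T.le_opNorm _

theorem exists_opMatrix_eq {a : Matrix I I ℂ} (ha : ActsBoundedly a 2 (fun _ => 1)) :
    ∃ T, opMatrix T = a := by
  classical
  obtain ⟨C, hC⟩ := ha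
  simp only [weighted_one] at hC
  let T : lp (fun _ : I => ℂ) 2 →ₗ[ℂ] lp (fun _ : I => ℂ) 2 :=
    { toFun := fun c => ⟨matVec a c, (hC c (lp.memℓp c)).2.1⟩
      map_add' := fun c d => by
        ext i
        simp only [matVec, lp.coeFn_add, Pi.add_apply, mul_add]
        exact ((hC c (lp.memℓp c)).1 i).tsum_add ((hC d (lp.memℓp d)).1 i)
      map_smul' := fun z c => by
        ext i
        simp only [matVec, lp.coeFn_smul, Pi.smul_apply, smul_eq_mul, mul_left_comm _ z]
        exact tsum_mul_left }
  refine ⟨T.mkContinuous C fun c => (hC c (lp.memℓp c)).2.2, ?_⟩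
  ext i j
  change ∑' k, a i k * (Pi.single j 1 : I → ℂ) k = a i j
  rw [tsum_eq_single j]
  · simp
  · intro k hk
    simp [hk]

end OperatorMatrices

/-! ### A spectral matrix algebra as a Banach algebra of operators -/

section OperatorAlgebra

variable {I : Type*} (𝒜 : SpectralMatrixAlgebra I)

/-- The operators on `ℓ²(I)` with matrix in `𝒜`, a subalgebra of `B(ℓ²(I))`. -/
def opSubalgebra : Subalgebra ℂ (lp (fun _ : I => ℂ) 2 →L[ℂ] lp (fun _ : I => ℂ) 2) where
  carrier := {T | opMatrix T ∈ 𝒜.carrier}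
  mul_mem' {S T} hS hT := by
    rw [Set.mem_ofPred_eq, opMatrix_mul]
    exact 𝒜.mul_mem _ hS _ hT
  add_mem' {S T} hS hT := by
    rw [Set.mem_ofPred_eq, map_add]
    exact 𝒜.carrier.add_mem hS hT
  algebraMap_mem' z := by
    rw [Set.mem_ofPred_eq, Algebra.algebraMap_eq_smul_one, map_smul, opMatrix_one]
    exact 𝒜.carrier.smul_mem z 𝒜.one_mem

/-- `opSubalgebra 𝒜` as a type, to be normed by the norm of `𝒜` and not by the operator norm. -/
def OpAlgebra : Type _ := opSubalgebra 𝒜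

namespace OpAlgebra

instance : Ring (OpAlgebra 𝒜) := inferInstanceAs (Ring (opSubalgebra 𝒜))

instance : Algebra ℂ (OpAlgebra 𝒜) := inferInstanceAs (Algebra ℂ (opSubalgebra 𝒜))

variable {𝒜}

/-- The underlying operator. -/
def toOp : OpAlgebra 𝒜 →ₐ[ℂ] (lp (fun _ : I => ℂ) 2 →L[ℂ] lp (fun _ : I => ℂ) 2) :=
  (opSubalgebra 𝒜).val

theorem toOp_injective : Function.Injective (toOp (𝒜 := 𝒜)) := Subtype.val_injective

/-- The underlying matrix. -/
def toMatrix : OpAlgebra 𝒜 →ₗ[ℂ] Matrix I I ℂ := opMatrix ∘ₗ toOp.toLinearMap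

theorem toMatrix_mem (a : OpAlgebra 𝒜) : toMatrix a ∈ 𝒜.carrier := a.2

theorem toMatrix_injective : Function.Injective (toMatrix (𝒜 := 𝒜)) :=
  opMatrix_injective.comp toOp_injective

theorem exists_toMatrix_eq {a : Matrix I I ℂ} (ha : a ∈ 𝒜.carrier) :
    ∃ b : OpAlgebra 𝒜, toMatrix b = a := by
  obtain ⟨T, rfl⟩ := exists_opMatrix_eq (𝒜.bounded a ha)
  exact ⟨⟨T, ha⟩, rfl⟩

theorem toMatrix_mul (a b : OpAlgebra 𝒜) :
    toMatrix (a * b) = matMul (toMatrix a) (toMatrix b) := opMatrix_mul _ _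

/-- The norm of `𝒜` as a norm on the operators. -/
def groupNorm : AddGroupNorm (OpAlgebra 𝒜) where
  toFun a := 𝒜.norm (toMatrix a)
  map_zero' := by rw [map_zero]; exact (𝒜.norm_eq_zero_iff 0 (zero_mem _)).2 rfl
  add_le' a b := by
    rw [map_add]
    exact 𝒜.norm_add_le _ (toMatrix_mem a) _ (toMatrix_mem b)
  neg' a := by
    have h := 𝒜.norm_smul (-1) _ (toMatrix_mem a)
    rwa [neg_one_smul, norm_neg, norm_one, one_mul, ← map_neg] at h
  eq_zero_of_map_eq_zero' a ha :=
    toMatrix_injective (((𝒜.norm_eq_zero_iff _ (toMatrix_mem a)).1 ha).trans (map_zero _).symm)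

instance : NormedRing (OpAlgebra 𝒜) where
  __ := groupNorm.toNormedAddCommGroup
  __ := (inferInstance : Ring (OpAlgebra 𝒜))
  norm_mul_le a b := by
    have h := 𝒜.norm_mul_le _ (toMatrix_mem a) _ (toMatrix_mem b)
    rwa [← toMatrix_mul] at h

theorem norm_def (a : OpAlgebra 𝒜) : ‖a‖ = 𝒜.norm (toMatrix a) := rfl

instance : NormedAlgebra ℂ (OpAlgebra 𝒜) where
  norm_smul_le z a := by
    rw [norm_def, map_smul]
    exact (𝒜.norm_smul z _ (toMatrix_mem a)).le

instance : CompleteSpace (OpAlgebra 𝒜) := by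
  refine Metric.complete_of_cauchySeq_tendsto fun u hu => ?_
  obtain ⟨a, ha, hlim⟩ := 𝒜.complete (fun n => toMatrix (u n)) (fun n => toMatrix_mem _) (by
    intro ε hε
    obtain ⟨N, hN⟩ := Metric.cauchySeq_iff.1 hu ε hε
    refine ⟨N, fun m hm n hn => ?_⟩
    have := hN m hm n hn
    rwa [dist_eq_norm, norm_def, map_sub] at this)
  obtain ⟨b, rfl⟩ := exists_toMatrix_eq ha
  refine ⟨b, Metric.tendsto_atTop.2 fun ε hε => ?_⟩
  obtain ⟨N, hN⟩ := hlim ε hε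
  refine ⟨N, fun n hn => ?_⟩
  rw [dist_eq_norm, norm_def, map_sub]
  exact hN n hn

/-- Solidity makes the matrix entries continuous: `a i j` times the matrix unit at `(i, j)` is
dominated by `a`. -/
theorem exists_norm_entry_le (i j : I) :
    ∃ K : ℝ, ∀ a : OpAlgebra 𝒜, ‖toMatrix a i j‖ ≤ K * ‖a‖ := by
  classical
  by_cases h : ∀ a : OpAlgebra 𝒜, toMatrix a i j = 0
  · exact ⟨0, fun a => by simp [h a]⟩
  push Not at h
  obtain ⟨a₀, h₀⟩ := h
  let E : Matrix I I ℂ := fun k l => if k = i ∧ l = j then 1 else 0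
  have hE (a : OpAlgebra 𝒜) : ∀ k l, ‖(toMatrix a i j • E) k l‖ ≤ ‖toMatrix a k l‖ := by
    intro k l
    change ‖toMatrix a i j * E k l‖ ≤ _
    by_cases hkl : k = i ∧ l = j
    · obtain ⟨rfl, rfl⟩ := hkl
      simp [E]
    · simp [E, hkl]
  have hEmem : E ∈ 𝒜.carrier := by
    have := 𝒜.carrier.smul_mem (toMatrix a₀ i j)⁻¹ (𝒜.solid _ (toMatrix_mem a₀) _ (hE a₀)).1
    rwa [smul_smul, inv_mul_cancel₀ h₀, one_smul] at this
  have hE0 : E ≠ 0 := fun h0 => by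
    have : E i j = 0 := by rw [h0]; rfl
    simp [E] at this
  have hpos : 0 < 𝒜.norm E := (𝒜.norm_nonneg E hEmem).lt_of_ne'
    fun h0 => hE0 ((𝒜.norm_eq_zero_iff E hEmem).1 h0)
  refine ⟨(𝒜.norm E)⁻¹, fun a => ?_⟩
  rw [inv_mul_eq_div, le_div_iff₀ hpos, ← 𝒜.norm_smul _ _ hEmem]
  exact (𝒜.solid _ (toMatrix_mem a) _ (hE a)).2

/-- The matrix entry at `(i, j)` as a continuous linear functional on `OpAlgebra 𝒜`. -/
def entry (i j : I) : OpAlgebra 𝒜 →L[ℂ] ℂ :=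
  LinearMap.mkContinuousOfExistsBound
    { toFun := fun a => toMatrix a i j
      map_add' := fun a b => by rw [map_add]; rfl
      map_smul' := fun z a => by rw [map_smul]; rfl } (exists_norm_entry_le i j)

theorem entry_apply (i j : I) (a : OpAlgebra 𝒜) : entry i j a = opMatrix (toOp a) i j := rfl

end OpAlgebra

open OpAlgebra

/-- Inverse-closedness: an element of the algebra that is invertible in `B(ℓ²)` is invertible in
the algebra. -/
theorem OpAlgebra.exists_inverse (a : OpAlgebra 𝒜)
    (T : lp (fun _ : I => ℂ) 2 →L[ℂ] lp (fun _ : I => ℂ) 2)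
    (h₁ : toOp a * T = 1) (h₂ : T * toOp a = 1) :
    ∃ u : (OpAlgebra 𝒜)ˣ, (u : OpAlgebra 𝒜) = a ∧ toOp (u⁻¹ : (OpAlgebra 𝒜)ˣ).val = T := by
  have hT : opMatrix T ∈ 𝒜.carrier := by
    refine 𝒜.inverse_closed _ (toMatrix_mem a) _ (actsBoundedly_opMatrix T) ?_ ?_
    · exact (opMatrix_mul (toOp a) T).symm.trans (by rw [h₁, opMatrix_one])
    · exact (opMatrix_mul T (toOp a)).symm.trans (by rw [h₂, opMatrix_one])
  exact ⟨⟨a, ⟨T, hT⟩, toOp_injective h₁, toOp_injective h₂⟩, rfl, rfl⟩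

/-- If the resolvent of an operator `G` with matrix in `𝒜` has the form `z⁻¹ (1 - P) + Q z` on a
circle around `0`, with `Q` holomorphic in the disc, then the matrix of `P` is in `𝒜`: the Riesz
integral of the resolvent over the circle can be formed in the Banach algebra `𝒜`, and its entries
are those of `1 - P`. -/
theorem opMatrix_mem_of_resolvent {G P : lp (fun _ : I => ℂ) 2 →L[ℂ] lp (fun _ : I => ℂ) 2}
    (hG : opMatrix G ∈ 𝒜.carrier) {r : ℝ} (hr : 0 < r)
    {Q : ℂ → lp (fun _ : I => ℂ) 2 →L[ℂ] lp (fun _ : I => ℂ) 2}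
    (hQ : DifferentiableOn ℂ Q (Metric.closedBall 0 r))
    (hl : ∀ z ∈ Metric.sphere (0 : ℂ) r, (z • 1 - G) * (z⁻¹ • (1 - P) + Q z) = 1)
    (hr' : ∀ z ∈ Metric.sphere (0 : ℂ) r, (z⁻¹ • (1 - P) + Q z) * (z • 1 - G) = 1) :
    opMatrix P ∈ 𝒜.carrier := by
  classical
  let g : OpAlgebra 𝒜 := ⟨G, hG⟩
  have hg (z : ℂ) : toOp (algebraMap ℂ (OpAlgebra 𝒜) z - g) = z • 1 - G := by
    rw [map_sub, AlgHom.commutes, Algebra.algebraMap_eq_smul_one]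
    rfl
  have hres : ∀ z ∈ Metric.sphere (0 : ℂ) r, z ∈ resolventSet ℂ g ∧
      toOp (resolvent g z) = z⁻¹ • (1 - P) + Q z := by
    intro z hz
    obtain ⟨u, hu, hu'⟩ := exists_inverse 𝒜 (algebraMap ℂ (OpAlgebra 𝒜) z - g) _
      (by rw [hg]; exact hl z hz) (by rw [hg]; exact hr' z hz)
    refine ⟨⟨u, hu⟩, ?_⟩
    rw [resolvent, ← hu, Ring.inverse_unit, hu']
  have hcont : ContinuousOn (resolvent g) (Metric.sphere (0 : ℂ) r) := fun z hz =>
    (spectrum.hasDerivAt_resolvent_const_left (hres z hz).1).continuousAt.continuousWithinAt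
  have hcontQ (i j : I) : DifferentiableOn ℂ (fun z => opMatrix (Q z) i j)
      (Metric.closedBall 0 r) :=
    ((lp.evalCLM ℂ (fun _ : I => ℂ) 2 i).comp
      (ContinuousLinearMap.apply ℂ _ (lp.single 2 j 1))).differentiable.comp_differentiableOn hQ
  let q : OpAlgebra 𝒜 := (2 * Real.pi * Complex.I : ℂ)⁻¹ • ∮ z in C(0, r), resolvent g z
  have hq : toMatrix q = opMatrix (1 - P) := by
    ext i j
    have h1 : entry i j (∮ z in C(0, r), resolvent g z) =
        ∮ z in C(0, r), entry i j (resolvent g z) := by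
      have hint : CircleIntegrable (resolvent g) 0 r := hcont.circleIntegrable hr.le
      simp only [circleIntegral]
      rw [← ContinuousLinearMap.intervalIntegral_comp_comm _ hint.out]
      simp only [map_smul]
    have h2 : (∮ z in C(0, r), entry i j (resolvent g z)) =
        ∮ z in C(0, r), ((z - 0)⁻¹ * opMatrix (1 - P) i j + opMatrix (Q z) i j) := by
      refine circleIntegral.integral_congr hr.le fun z hz => ?_
      simp only [entry_apply]
      rw [(hres z hz).2, map_add, map_smul, sub_zero]
      rfl
    have h3 : (∮ z in C(0, r), opMatrix (Q z) i j) = 0 := by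
      refine DiffContOnCl.circleIntegral_eq_zero hr.le (DifferentiableOn.diffContOnCl ?_)
      rw [closure_ball _ hr.ne']
      exact hcontQ i j
    have h4 : CircleIntegrable (fun z : ℂ => (z - 0)⁻¹ * opMatrix (1 - P) i j) 0 r := by
      refine ContinuousOn.circleIntegrable hr.le (ContinuousOn.mul (ContinuousOn.inv₀ ?_ ?_) ?_)
      · fun_prop
      · intro z hz h0
        rw [sub_zero] at h0
        subst h0
        simp at hz
        exact hr.ne hz
      · fun_prop
    have h5 : CircleIntegrable (fun z : ℂ => opMatrix (Q z) i j) 0 r :=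
      ((hcontQ i j).continuousOn.mono Metric.sphere_subset_closedBall).circleIntegrable hr.le
    have h6 : (∮ z in C(0, r), (z - 0)⁻¹ * opMatrix (1 - P) i j) =
        2 * Real.pi * Complex.I * opMatrix (1 - P) i j := by
      have := circleIntegral.integral_smul_const (fun z : ℂ => (z - 0)⁻¹) (opMatrix (1 - P) i j) 0 r
      rw [circleIntegral.integral_sub_center_inv 0 hr.ne'] at this
      exact this
    change entry i j q = _
    rw [map_smul, h1, h2, circleIntegral.integral_add h4 h5, h3, h6, add_zero, smul_eq_mul,
      inv_mul_cancel_left₀ Complex.two_pi_I_ne_zero]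
  have hP : opMatrix P = matOne - toMatrix q := by
    rw [hq, map_sub, opMatrix_one, sub_sub_cancel]
  rw [hP]
  exact 𝒜.carrier.sub_mem 𝒜.one_mem (toMatrix_mem q)

end OperatorAlgebra

/-! ### Bessel families and frames -/

section Bessel

variable {I H : Type*} [NormedAddCommGroup H] [InnerProductSpace ℂ H]

/-- Bessel families, by a bound on the finite partial sums. -/
def IsBessel (ψ : I → H) : Prop :=
  ∃ B : ℝ, 0 ≤ B ∧ ∀ (f : H) (s : Finset I), ∑ i ∈ s, ‖inner ℂ (ψ i) f‖ ^ 2 ≤ B * ‖f‖ ^ 2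

theorem IsFrame.isBessel {ψ : I → H} (h : IsFrame ψ) : IsBessel ψ := by
  obtain ⟨A, B, -, hB, h⟩ := h
  exact ⟨B, hB.le, fun f s =>
    ((h f).1.sum_le_tsum s fun i _ => sq_nonneg _).trans (h f).2.2⟩

variable {ψ : I → H}

theorem norm_sq_eq_tsum (c : lp (fun _ : I => ℂ) 2) : ‖c‖ ^ 2 = ∑' i, ‖c i‖ ^ 2 := by
  simpa using lp.norm_rpow_eq_tsum (p := 2) (by simp) c

theorem summable_norm_sq (c : lp (fun _ : I => ℂ) 2) : Summable fun i => ‖c i‖ ^ 2 := by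
  simpa using (lp.memℓp c).summable (by simp)

theorem IsBessel.memℓp (h : IsBessel ψ) (f : H) : Memℓp (analysis ψ f) 2 := by
  obtain ⟨B, -, h⟩ := h
  exact memℓp_gen' (C := B * ‖f‖ ^ 2) fun s => by simpa [analysis] using h f s

/-- The analysis operator of a Bessel family as a bounded operator into `ℓ²`. -/
def IsBessel.analysisCLM (h : IsBessel ψ) : H →L[ℂ] lp (fun _ : I => ℂ) 2 :=
  LinearMap.mkContinuousOfExistsBound
    { toFun := fun f => ⟨analysis ψ f, h.memℓp f⟩
      map_add' := fun f g => Subtype.ext (map_add (analysis ψ) f g)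
      map_smul' := fun z f => Subtype.ext (map_smul (analysis ψ) z f) } (by
    obtain ⟨B, hB, hs⟩ := h
    refine ⟨√B, fun f => ?_⟩
    refine lp.norm_le_of_forall_sum_le (by simp) (by positivity) fun s => ?_
    have := hs f s
    rw [← Real.sq_sqrt hB, ← mul_pow] at this
    simpa [analysis] using this)

theorem IsBessel.analysisCLM_apply (h : IsBessel ψ) (f : H) (i : I) :
    h.analysisCLM f i = inner ℂ (ψ i) f := rfl

theorem IsBessel.norm_analysisCLM_sq (h : IsBessel ψ) (f : H) :
    ‖h.analysisCLM f‖ ^ 2 = ∑' i, ‖inner ℂ (ψ i) f‖ ^ 2 := norm_sq_eq_tsum _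

variable [CompleteSpace H]

/-- The synthesis operator of a Bessel family. -/
def IsBessel.synthesisCLM (h : IsBessel ψ) : lp (fun _ : I => ℂ) 2 →L[ℂ] H :=
  ContinuousLinearMap.adjoint h.analysisCLM

open Classical in
theorem IsBessel.synthesisCLM_single (h : IsBessel ψ) (i : I) :
    h.synthesisCLM (lp.single 2 i 1) = ψ i := by
  refine ext_inner_right ℂ fun f => ?_
  rw [synthesisCLM, ContinuousLinearMap.adjoint_inner_left, lp.inner_single_left,
    h.analysisCLM_apply]
  simp

theorem IsBessel.hasSum_synthesisCLM (h : IsBessel ψ) (c : lp (fun _ : I => ℂ) 2) :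
    HasSum (fun i => c i • ψ i) (h.synthesisCLM c) := by
  classical
  convert hasSum_map_single (by simp) h.synthesisCLM c using 1
  ext i
  rw [h.synthesisCLM_single]

/-- The frame operator of a Bessel family as a bounded operator. -/
def IsBessel.frameCLM (h : IsBessel ψ) : H →L[ℂ] H := h.synthesisCLM ∘L h.analysisCLM

theorem IsBessel.hasSum_frameCLM (h : IsBessel ψ) (f : H) :
    HasSum (fun i => inner ℂ (ψ i) f • ψ i) (h.frameCLM f) :=
  h.hasSum_synthesisCLM (h.analysisCLM f)

theorem IsBessel.frameOperator_eq (h : IsBessel ψ) : frameOperator ψ = h.frameCLM :=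
  funext fun f => (h.hasSum_frameCLM f).tsum_eq

theorem IsBessel.inner_frameCLM_left (h : IsBessel ψ) (f g : H) :
    inner ℂ (h.frameCLM f) g = inner ℂ (h.analysisCLM f) (h.analysisCLM g) := by
  rw [frameCLM, ContinuousLinearMap.comp_apply, synthesisCLM,
    ContinuousLinearMap.adjoint_inner_left]

theorem IsBessel.inner_frameCLM_comm (h : IsBessel ψ) (f g : H) :
    inner ℂ (h.frameCLM f) g = inner ℂ f (h.frameCLM g) := by
  rw [h.inner_frameCLM_left]
  rw [frameCLM, ContinuousLinearMap.comp_apply, synthesisCLM,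
    ContinuousLinearMap.adjoint_inner_right]

/-- A Bessel family whose frame operator is bounded below is a frame. -/
theorem IsBessel.isFrame (h : IsBessel ψ) {K : ℝ} (hK : ∀ f, ‖f‖ ≤ K * ‖h.frameCLM f‖) :
    IsFrame ψ := by
  obtain ⟨B, hB, hs⟩ := id h
  set D := h.synthesisCLM
  have hle (f : H) : ‖f‖ ≤ (|K| * ‖D‖ + 1) * ‖h.analysisCLM f‖ := by
    calc ‖f‖ ≤ |K| * ‖D (h.analysisCLM f)‖ :=
          (hK f).trans (mul_le_mul_of_nonneg_right (le_abs_self K) (norm_nonneg _))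
      _ ≤ |K| * (‖D‖ * ‖h.analysisCLM f‖) := by gcongr; exact D.le_opNorm _
      _ ≤ (|K| * ‖D‖ + 1) * ‖h.analysisCLM f‖ := by nlinarith [norm_nonneg (h.analysisCLM f)]
  have hpos : 0 < |K| * ‖D‖ + 1 := by positivity
  refine ⟨((|K| * ‖D‖ + 1) ^ 2)⁻¹, B + 1, by positivity, by positivity, fun f => ?_⟩
  refine ⟨summable_norm_sq (h.analysisCLM f), ?_, ?_⟩
  · rw [← h.norm_analysisCLM_sq, inv_mul_le_iff₀ (by positivity), ← mul_pow]
    gcongr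
    exact hle f
  · refine (Real.tsum_le_of_sum_le (fun _ => sq_nonneg _) (hs f)).trans ?_
    nlinarith [sq_nonneg ‖f‖]

theorem IsFrame.isUnit_frameCLM (h : IsFrame ψ) : IsUnit h.isBessel.frameCLM := by
  obtain ⟨A, B, hA, hB, hf⟩ := id h
  refine ContinuousLinearMap.isUnit_of_forall_le_norm_inner_map _ (c := ⟨A, hA.le⟩) hA fun f => ?_
  rw [h.isBessel.inner_frameCLM_left, inner_self_eq_norm_sq_to_K, norm_pow]
  simp only [Complex.coe_algebraMap, Complex.norm_real, norm_norm]
  rw [h.isBessel.norm_analysisCLM_sq, mul_comm]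
  exact (hf f).2.1

/-- The inverse of the frame operator. -/
def IsFrame.frameInv (h : IsFrame ψ) : H →L[ℂ] H := Ring.inverse h.isBessel.frameCLM

theorem IsFrame.frameCLM_mul_frameInv (h : IsFrame ψ) : h.isBessel.frameCLM * h.frameInv = 1 :=
  Ring.mul_inverse_cancel _ h.isUnit_frameCLM

theorem IsFrame.frameInv_mul_frameCLM (h : IsFrame ψ) : h.frameInv * h.isBessel.frameCLM = 1 :=
  Ring.inverse_mul_cancel _ h.isUnit_frameCLM

theorem IsFrame.frameCLM_frameInv (h : IsFrame ψ) (f : H) :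
    h.isBessel.frameCLM (h.frameInv f) = f := congr($(h.frameCLM_mul_frameInv) f)

theorem IsFrame.frameInv_frameCLM (h : IsFrame ψ) (f : H) :
    h.frameInv (h.isBessel.frameCLM f) = f := congr($(h.frameInv_mul_frameCLM) f)

theorem IsFrame.inner_frameInv_comm (h : IsFrame ψ) (f g : H) :
    inner ℂ (h.frameInv f) g = inner ℂ f (h.frameInv g) := by
  conv_lhs => rw [← h.frameCLM_frameInv g]
  rw [← h.isBessel.inner_frameCLM_comm, h.frameCLM_frameInv]

theorem IsFrame.canonicalDual_eq (h : IsFrame ψ) (i : I) :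
    canonicalDual ψ i = h.frameInv (ψ i) := by
  have hinj : Function.Injective (frameOperator ψ) := by
    rw [h.isBessel.frameOperator_eq]
    exact Function.LeftInverse.injective h.frameInv_frameCLM
  rw [canonicalDual]
  conv_lhs => rw [← h.frameCLM_frameInv (ψ i), ← h.isBessel.frameOperator_eq]
  exact Function.leftInverse_invFun hinj _

/-- The coefficients with respect to the canonical dual frame. -/
theorem IsFrame.inner_canonicalDual (h : IsFrame ψ) (i : I) (f : H) :
    inner ℂ (canonicalDual ψ i) f = inner ℂ (ψ i) (h.frameInv f) := by
  rw [h.canonicalDual_eq, h.inner_frameInv_comm]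

/-- The reconstruction formula `f = ∑_i ⟨f, ψ~_i⟩ ψ_i`. -/
theorem IsFrame.hasSum_reconstruction (h : IsFrame ψ) (f : H) :
    HasSum (fun i => inner ℂ (canonicalDual ψ i) f • ψ i) f := by
  simp only [h.inner_canonicalDual]
  have := h.isBessel.hasSum_frameCLM (h.frameInv f)
  rwa [h.frameCLM_frameInv] at this

end Bessel

/-! ### The cross Gram matrix of a localised frame and its dual -/

section CrossGram

variable {I H : Type*} [NormedAddCommGroup H] [InnerProductSpace ℂ H] [CompleteSpace H]
  {𝒜 : SpectralMatrixAlgebra I} {ψ : I → H}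

/-- The matrix `(⟨ψ_{i'}, ψ~_i⟩)_{i,i'}` belongs to `𝒜`: with the analysis operator `C`, the Gram
matrix is that of `C C^*`, whose spectrum has `0` at most as an isolated point because `S = C^* C`
is invertible, and `(⟨ψ_{i'}, ψ~_i⟩)` is the matrix of the complementary spectral projection
`C S⁻¹ C^*`. -/
theorem SpectralMatrixAlgebra.IsLocalised.crossGram_mem (h : 𝒜.IsLocalised ψ) :
    (fun i j => inner ℂ (canonicalDual ψ i) (ψ j) : Matrix I I ℂ) ∈ 𝒜.carrier := by
  classical
  have hF := h.isFrame
  let C := hF.isBessel.analysisCLM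
  let D := hF.isBessel.synthesisCLM
  let S := hF.isBessel.frameCLM
  let R := hF.frameInv
  have hG : opMatrix (C ∘L D) ∈ 𝒜.carrier := by
    convert h.gram_mem using 1
    ext i j
    simp [opMatrix_apply, C, D, hF.isBessel.synthesisCLM_single, hF.isBessel.analysisCLM_apply,
      Matrix.gram_apply]
  have hPmat : (fun i j => inner ℂ (canonicalDual ψ i) (ψ j) : Matrix I I ℂ) =
      opMatrix (C ∘L R ∘L D) := by
    ext i j
    simp [opMatrix_apply, C, D, R, hF.isBessel.synthesisCLM_single,
      hF.isBessel.analysisCLM_apply, hF.inner_canonicalDual]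
  rw [hPmat]
  have h0 : (0 : ℂ) ∈ resolventSet ℂ S := by
    rw [spectrum.mem_resolventSet_iff, map_zero, zero_sub]
    exact hF.isUnit_frameCLM.neg
  obtain ⟨r, hr, hball⟩ := Metric.nhds_basis_closedBall.mem_iff.1
    ((spectrum.isOpen_resolventSet S).mem_nhds h0)
  have hinv : ∀ z ∈ Metric.closedBall (0 : ℂ) r,
      (∀ f, z • resolvent S z f - S (resolvent S z f) = f) ∧
      ∀ f, resolvent S z (z • f - S f) = f := by
    intro z hz
    have hu := spectrum.mem_resolventSet_iff.1 (hball hz)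
    constructor <;> intro f
    · have := congr($(Ring.mul_inverse_cancel _ hu) f)
      simpa [Algebra.algebraMap_eq_smul_one, resolvent] using this
    · have := congr($(Ring.inverse_mul_cancel _ hu) f)
      simpa [Algebra.algebraMap_eq_smul_one, resolvent] using this
  have hSR (f : H) : S (R f) = f := hF.frameCLM_frameInv f
  have hRS (f : H) : R (S f) = f := hF.frameInv_frameCLM f
  have hDC (f : H) : D (C f) = S f := rfl
  -- On the range of `C`, where `C C^*` is similar to `S`, the resolvent is `C S⁻¹ (z - S)⁻¹ C^*`.
  refine opMatrix_mem_of_resolvent 𝒜 hG hr (Q := fun z => C ∘L R ∘L resolvent S z ∘L D)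
    ?_ ?_ ?_
  · have : DifferentiableOn ℂ (fun z : ℂ => resolvent S z) (Metric.closedBall 0 r) := fun z hz =>
      (spectrum.hasDerivAt_resolvent_const_left
        (hball hz)).differentiableAt.differentiableWithinAt
    have hc : DifferentiableOn ℂ (fun _ : ℂ => D) (Metric.closedBall 0 r) :=
      differentiableOn_const _
    have hc' : DifferentiableOn ℂ (fun _ : ℂ => C ∘L R) (Metric.closedBall 0 r) :=
      differentiableOn_const _
    exact hc'.clm_comp (this.clm_comp hc)
  · intro z hz
    have hz0 : z ≠ 0 := by
      rintro rfl
      simp at hz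
      exact hr.ne hz
    obtain ⟨h1, -⟩ := hinv z (Metric.sphere_subset_closedBall hz)
    ext1 c
    change z • (z⁻¹ • (c - C (R (D c))) + C (R (resolvent S z (D c)))) -
      C (D (z⁻¹ • (c - C (R (D c))) + C (R (resolvent S z (D c))))) = c
    have hD : D (z⁻¹ • (c - C (R (D c))) + C (R (resolvent S z (D c)))) = resolvent S z (D c) := by
      rw [map_add, map_smul, map_sub, hDC, hDC, hSR, hSR, sub_self, smul_zero, zero_add]
    have hC := congrArg (fun f => C (R f)) (h1 (D c))
    simp only [map_sub, map_smul, hRS] at hC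
    rw [hD, smul_add, smul_inv_smul₀ hz0, ← hC]
    abel
  · intro z hz
    have hz0 : z ≠ 0 := by
      rintro rfl
      simp at hz
      exact hr.ne hz
    obtain ⟨-, h1⟩ := hinv z (Metric.sphere_subset_closedBall hz)
    ext1 c
    change z⁻¹ • (z • c - C (D c) - C (R (D (z • c - C (D c))))) +
      C (R (resolvent S z (D (z • c - C (D c))))) = c
    have hD : D (z • c - C (D c)) = z • D c - S (D c) := by rw [map_sub, map_smul, hDC]
    have hz' : z • c - C (D c) - (z • C (R (D c)) - C (D c)) = z • (c - C (R (D c))) := by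
      rw [smul_sub]
      abel
    rw [hD, h1, map_sub, map_smul, hRS, map_sub, map_smul, hz', inv_smul_smul₀ hz0,
      sub_add_cancel]

end CrossGram

/-! ### Atomic decompositions in the co-orbit spaces -/

section Atoms

variable {I H : Type*} [NormedAddCommGroup H] [InnerProductSpace ℂ H]

/-- A frame with positive weight whose elements satisfy `‖ψ_i‖ ≤ K w_i` in the co-orbit norm
`‖C_{ψ~} f‖_{ℓ^1_w}`. -/
structure IsAtomic (ψ : I → H) (w : I → ℝ) : Prop where
  isFrame : IsFrame ψ
  pos : ∀ i, 0 < w i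
  exists_bound : ∃ K : ℝ, 0 ≤ K ∧ ∀ i, ∃ h : Memℓp (weightedCoeff ψ w (ψ i)) 1,
    ‖(⟨weightedCoeff ψ w (ψ i), h⟩ : lp (fun _ : I => ℂ) 1)‖ ≤ K * w i

theorem weightedCoeff_apply (ψ : I → H) (w : I → ℝ) (f : H) (i : I) :
    weightedCoeff ψ w f i = w i * inner ℂ (canonicalDual ψ i) f := rfl

/-- The columns of the matrix `(⟨ψ_{i'}, ψ~_i⟩)_{i,i'}` are its values at the unit vectors, which have
norm `w_{i'}` in `ℓ^1_w`, so that admissibility bounds them. -/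
theorem SpectralMatrixAlgebra.IsLocalised.isAtomic [CompleteSpace H]
    {𝒜 : SpectralMatrixAlgebra I} {ψ : I → H} {w : I → ℝ}
    (h : 𝒜.IsLocalised ψ) (hw : 𝒜.IsAdmissible w) : IsAtomic ψ w := by
  classical
  refine ⟨h.isFrame, hw.pos, ?_⟩
  obtain ⟨K, hK⟩ := hw.bounded _ h.crossGram_mem 1 le_rfl
  refine ⟨|K|, abs_nonneg K, fun j => ?_⟩
  have hsingle : weighted w (Pi.single j 1) = lp.single (E := fun _ : I => ℂ) 1 j (w j : ℂ) := by
    ext i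
    rcases eq_or_ne i j with rfl | hij
    · simp [weighted]
    · simp [weighted, hij]
  have hmem : Memℓp (weighted w (Pi.single j 1)) 1 := hsingle ▸ lp.memℓp _
  have hcol : weighted w (matVec (fun i j => inner ℂ (canonicalDual ψ i) (ψ j)) (Pi.single j 1)) =
      weightedCoeff ψ w (ψ j) := by
    ext i
    rw [weightedCoeff_apply]
    refine congrArg ((w i : ℂ) * ·) ((tsum_eq_single j fun k hk => ?_).trans ?_)
    · simp [hk]
    · simp
  obtain ⟨-, hm, hle⟩ := hK _ hmem
  simp only [hcol] at hm hle
  refine ⟨hm, hle.trans ?_⟩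
  have hn : ‖(⟨_, hmem⟩ : lp (fun _ : I => ℂ) 1)‖ = w j := by
    rw [show (⟨_, hmem⟩ : lp (fun _ : I => ℂ) 1) = lp.single 1 j (w j : ℂ) from
      Subtype.ext hsingle, lp.norm_single one_pos, Complex.norm_real, Real.norm_of_nonneg
      (hw.pos j).le]
  rw [hn]
  exact mul_le_mul_of_nonneg_right (le_abs_self K) (hw.pos j).le

variable {ψ : I → H} {w : I → ℝ}

theorem IsAtomic.coorbitNormWellDefined [CompleteSpace H] (h : IsAtomic ψ w) :
    CoorbitNormWellDefined ψ w := by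
  obtain ⟨K, -, hK⟩ := h.exists_bound
  intro f hf
  constructor
  · have hle : H00 ψ ≤ preCoorbitSubmodule ψ w := by
      refine Submodule.span_le.2 ?_
      rintro _ ⟨i, rfl⟩
      exact ⟨Submodule.subset_span ⟨i, rfl⟩, (hK i).1⟩
    exact (hle hf).2
  · intro h0
    have hc (i : I) : inner ℂ (canonicalDual ψ i) f = 0 := by
      have := congrFun h0 i
      rw [weightedCoeff_apply] at this
      exact (mul_eq_zero.1 this).resolve_left (Complex.ofReal_ne_zero.2 (h.pos i).ne')
    have := h.isFrame.hasSum_reconstruction f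
    simp only [hc, zero_smul] at this
    exact this.unique hasSum_zero

/-- The frame element `ψ_i` as an element of `H_00(ψ)` with the co-orbit norm. -/
def IsAtomic.atom (h : IsAtomic ψ w) (i : I) : PreCoorbit ψ w :=
  ⟨ψ i, Submodule.subset_span ⟨i, rfl⟩, (h.exists_bound.choose_spec.2 i).1⟩

theorem IsAtomic.val_atom (h : IsAtomic ψ w) (i : I) : (h.atom i).val = ψ i := rfl

theorem IsAtomic.exists_norm_atom_le (h : IsAtomic ψ w) :
    ∃ K : ℝ, 0 ≤ K ∧ ∀ i, ‖h.atom i‖ ≤ K * w i :=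
  ⟨h.exists_bound.choose, h.exists_bound.choose_spec.1,
    fun i => (h.exists_bound.choose_spec.2 i).2⟩

/-- The coefficients `⟨f, ψ~_i⟩`. -/
def PreCoorbit.coeff (f : PreCoorbit ψ w) (i : I) : ℂ := inner ℂ (canonicalDual ψ i) f.val

theorem PreCoorbit.coeff_add (f g : PreCoorbit ψ w) (i : I) :
    (f + g).coeff i = f.coeff i + g.coeff i := by simp [coeff]

theorem PreCoorbit.coeff_smul (z : ℂ) (f : PreCoorbit ψ w) (i : I) :
    (z • f).coeff i = z * f.coeff i := by simp [coeff]

theorem PreCoorbit.toLp_apply (f : PreCoorbit ψ w) (i : I) :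
    PreCoorbit.toLp ψ w f i = w i * f.coeff i := rfl

/-- The co-orbit norm is `∑_i |⟨f, ψ~_i⟩| w_i`. -/
theorem IsAtomic.hasSum_norm (h : IsAtomic ψ w) (f : PreCoorbit ψ w) :
    HasSum (fun i => ‖f.coeff i‖ * w i) ‖f‖ := by
  have := lp.hasSum_norm (p := 1) (by simp) (PreCoorbit.toLp ψ w f)
  simp only [ENNReal.toReal_one, Real.rpow_one, PreCoorbit.toLp_apply, norm_mul,
    Complex.norm_real, Real.norm_of_nonneg (h.pos _).le, mul_comm (w _)] at this
  exact this

theorem IsAtomic.summable_norm_coeff_smul {X : Type*} [SeminormedAddCommGroup X]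
    [NormedSpace ℂ X] (h : IsAtomic ψ w) {a : I → X} {K : ℝ} (ha : ∀ i, ‖a i‖ ≤ K * w i)
    (f : PreCoorbit ψ w) : Summable fun i => ‖f.coeff i • a i‖ := by
  refine Summable.of_nonneg_of_le (fun _ => norm_nonneg _) (fun i => ?_)
    ((h.hasSum_norm f).summable.mul_left K)
  rw [norm_smul, mul_left_comm]
  exact mul_le_mul_of_nonneg_left (ha i) (norm_nonneg _)

/-- The reconstruction formula holds in the co-orbit norm: the series converges absolutely, and
the coefficients of its sum are those of `f` by the reconstruction formula in `H`. -/
theorem IsAtomic.hasSum_atom [CompleteSpace H] (h : IsAtomic ψ w) (f : PreCoorbit ψ w) :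
    HasSum (fun i => f.coeff i • h.atom i) f := by
  have hind : Topology.IsInducing (PreCoorbit.toLp ψ w) := ⟨rfl⟩
  rw [← hind.hasSum_iff (g := PreCoorbit.toLp ψ w)]
  obtain ⟨K, -, hK⟩ := h.exists_norm_atom_le
  have hsum : Summable (PreCoorbit.toLp ψ w ∘ fun i => f.coeff i • h.atom i) :=
    Summable.of_norm (h.summable_norm_coeff_smul hK f)
  obtain ⟨s, hs⟩ := hsum
  suffices s = PreCoorbit.toLp ψ w f from this ▸ hs
  ext k
  have h1 := hs.mapL (lp.evalCLM ℂ (fun _ : I => ℂ) 1 k)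
  have h2 := ((h.isFrame.hasSum_reconstruction f.val).mapL
    (innerSL ℂ (canonicalDual ψ k))).mul_left (w k : ℂ)
  have he (i : I) : lp.evalCLM ℂ (fun _ : I => ℂ) 1 k
      ((PreCoorbit.toLp ψ w ∘ fun i => f.coeff i • h.atom i) i) =
      w k * innerSL ℂ (canonicalDual ψ k) (inner ℂ (canonicalDual ψ i) f.val • ψ i) := by
    change (w k : ℂ) * (f.coeff i • h.atom i).coeff k = _
    rw [PreCoorbit.coeff_smul]
    simp [PreCoorbit.coeff, h.val_atom]
  simp only [he] at h1
  exact h1.unique h2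

end Atoms

/-! ### Tensor products of frames -/

section TensorFrames

open TensorProduct

theorem orthonormal_single (I : Type*) [DecidableEq I] :
    Orthonormal ℂ fun i : I => lp.single (E := fun _ : I => ℂ) 2 i 1 := by
  rw [orthonormal_iff_ite]
  intro i j
  rw [lp.inner_single_left]
  simp [Pi.single_apply]

variable {I J E F : Type*} [NormedAddCommGroup E] [InnerProductSpace ℂ E]
  [NormedAddCommGroup F] [InnerProductSpace ℂ F] {φ : I → E} {ψ : J → F}

/-- The coefficients `⟨t, φ_i ⊗ ψ_j⟩` are those of `(C_φ ⊗ C_ψ) t` in the orthonormal family of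
the `e_i ⊗ e_j`. -/
theorem IsBessel.tensor (hφ : IsBessel φ) (hψ : IsBessel ψ) :
    IsBessel fun ij : I × J =>
      ((φ ij.1 ⊗ₜ[ℂ] ψ ij.2 : E ⊗[ℂ] F) : UniformSpace.Completion (E ⊗[ℂ] F)) := by
  classical
  let A := mapL hφ.analysisCLM hψ.analysisCLM
  have ho := (orthonormal_single I).tmul (orthonormal_single J)
  have hinner (ij : I × J) (t : E ⊗[ℂ] F) : inner ℂ (φ ij.1 ⊗ₜ[ℂ] ψ ij.2) t =
      inner ℂ (lp.single (E := fun _ : I => ℂ) 2 ij.1 1 ⊗ₜ[ℂ]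
        lp.single (E := fun _ : J => ℂ) 2 ij.2 1) (A t) := by
    induction t using TensorProduct.induction_on with
    | zero => simp
    | tmul x y =>
      rw [mapL_tmul, inner_tmul, inner_tmul, lp.inner_single_left, lp.inner_single_left,
        hφ.analysisCLM_apply, hψ.analysisCLM_apply]
      simp
    | add s t hs ht => rw [inner_add_right, hs, ht, map_add, inner_add_right]
  refine ⟨‖A‖ ^ 2, sq_nonneg _, fun f s => ?_⟩
  induction f using UniformSpace.Completion.induction_on with
  | hp => exact isClosed_le (by fun_prop) (by fun_prop)
  | ih t =>
    simp only [UniformSpace.Completion.inner_coe, UniformSpace.Completion.norm_coe, hinner]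
    refine (ho.sum_inner_products_le (A t)).trans ?_
    rw [← mul_pow]
    gcongr
    exact A.le_opNorm t

variable [CompleteSpace E] [CompleteSpace F]

theorem IsBessel.frameCLM_tensor (hφ : IsBessel φ) (hψ : IsBessel ψ) (x : E) (y : F) :
    (hφ.tensor hψ).frameCLM ((x ⊗ₜ[ℂ] y : E ⊗[ℂ] F) : UniformSpace.Completion (E ⊗[ℂ] F)) =
      ((hφ.frameCLM x ⊗ₜ[ℂ] hψ.frameCLM y : E ⊗[ℂ] F) :
        UniformSpace.Completion (E ⊗[ℂ] F)) := by
  let c : E ⊗[ℂ] F →L[ℂ] UniformSpace.Completion (E ⊗[ℂ] F) :=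
    UniformSpace.Completion.toComplL
  have h1 (i : I) : HasSum (fun j : J => inner ℂ
      ((φ i ⊗ₜ[ℂ] ψ j : E ⊗[ℂ] F) : UniformSpace.Completion (E ⊗[ℂ] F))
      ((x ⊗ₜ[ℂ] y : E ⊗[ℂ] F) : UniformSpace.Completion (E ⊗[ℂ] F)) •
      ((φ i ⊗ₜ[ℂ] ψ j : E ⊗[ℂ] F) : UniformSpace.Completion (E ⊗[ℂ] F)))
      (c ((inner ℂ (φ i) x • φ i) ⊗ₜ[ℂ] hψ.frameCLM y)) := by
    have := (hψ.hasSum_frameCLM y).mapL (c ∘L mkL ℂ E F (inner ℂ (φ i) x • φ i))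
    simp only [ContinuousLinearMap.comp_apply, mkL_apply_apply, tmul_smul, smul_tmul',
      smul_smul] at this
    simp only [UniformSpace.Completion.inner_coe, inner_tmul]
    simp only [← UniformSpace.Completion.coe_smul, smul_tmul', mul_comm (inner ℂ (φ i) x)]
    exact this
  have h2 : HasSum (fun i => c ((inner ℂ (φ i) x • φ i) ⊗ₜ[ℂ] hψ.frameCLM y))
      (c (hφ.frameCLM x ⊗ₜ[ℂ] hψ.frameCLM y)) :=
    (hφ.hasSum_frameCLM x).mapL (c ∘L (mkL ℂ E F).flip (hψ.frameCLM y))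
  exact (((hφ.tensor hψ).hasSum_frameCLM _).prod_fiberwise h1).unique h2

/-- The frame operator of the tensor product of two frames has the inverse `S_φ⁻¹ ⊗ S_ψ⁻¹`. -/
theorem IsFrame.tensor (hφ : IsFrame φ) (hψ : IsFrame ψ) :
    IsFrame fun ij : I × J =>
      ((φ ij.1 ⊗ₜ[ℂ] ψ ij.2 : E ⊗[ℂ] F) : UniformSpace.Completion (E ⊗[ℂ] F)) := by
  let R := (mapL hφ.frameInv hψ.frameInv).completion
  refine (hφ.isBessel.tensor hψ.isBessel).isFrame (K := ‖R‖) fun f => ?_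
  suffices h : R ((hφ.isBessel.tensor hψ.isBessel).frameCLM f) = f by
    conv_lhs => rw [← h]
    exact R.le_opNorm _
  induction f using UniformSpace.Completion.induction_on with
  | hp => exact isClosed_eq (by fun_prop) continuous_id
  | ih t =>
    induction t using TensorProduct.induction_on with
    | zero => rw [UniformSpace.Completion.coe_zero, map_zero, map_zero]
    | tmul x y =>
      rw [hφ.isBessel.frameCLM_tensor hψ.isBessel, ContinuousLinearMap.completion_apply_coe, mapL_tmul,
        hφ.frameInv_frameCLM, hψ.frameInv_frameCLM]
    | add s t hs ht => rw [UniformSpace.Completion.coe_add, map_add, map_add, hs, ht]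

theorem IsFrame.frameInv_tensor (hφ : IsFrame φ) (hψ : IsFrame ψ) (x : E) (y : F) :
    (hφ.tensor hψ).frameInv ((x ⊗ₜ[ℂ] y : E ⊗[ℂ] F) : UniformSpace.Completion (E ⊗[ℂ] F)) =
      ((hφ.frameInv x ⊗ₜ[ℂ] hψ.frameInv y : E ⊗[ℂ] F) :
        UniformSpace.Completion (E ⊗[ℂ] F)) := by
  have h := hφ.isBessel.frameCLM_tensor hψ.isBessel (hφ.frameInv x) (hψ.frameInv y)
  rw [hφ.frameCLM_frameInv, hψ.frameCLM_frameInv] at h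
  rw [← h, IsFrame.frameInv_frameCLM]

end TensorFrames

section ConjugateFrames

variable {I H : Type*} [NormedAddCommGroup H] [InnerProductSpace ℂ H] {ψ : I → H}

instance [CompleteSpace H] : CompleteSpace (Conj H) := inferInstanceAs (CompleteSpace H)

theorem norm_inner_toConj (x y : H) : ‖inner ℂ (toConj x) (toConj y)‖ = ‖inner ℂ x y‖ := by
  rw [inner_toConj, norm_inner_symm]

theorem IsFrame.conj (h : IsFrame ψ) : IsFrame fun i => toConj (ψ i) := by
  obtain ⟨A, B, hA, hB, h⟩ := h
  refine ⟨A, B, hA, hB, fun f => ?_⟩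
  have hf := h (ofConj f)
  simp only [← norm_inner_toConj (ψ _)] at hf
  exact hf

variable [CompleteSpace H]

theorem IsFrame.frameCLM_conj (h : IsFrame ψ) (f : H) :
    h.conj.isBessel.frameCLM (toConj f) = toConj (h.isBessel.frameCLM f) := by
  refine (h.conj.isBessel.hasSum_frameCLM (toConj f)).unique ?_
  have := h.isBessel.hasSum_frameCLM f
  simp only [smul_toConj, inner_toConj, inner_conj_symm]
  exact this

theorem IsFrame.canonicalDual_conj (h : IsFrame ψ) (i : I) :
    canonicalDual (fun i => toConj (ψ i)) i = toConj (canonicalDual ψ i) := by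
  rw [h.conj.canonicalDual_eq, h.canonicalDual_eq]
  have := h.frameCLM_conj (h.frameInv (ψ i))
  rw [h.frameCLM_frameInv] at this
  rw [← this, h.conj.frameInv_frameCLM]

end ConjugateFrames

section TensorAtoms

variable {I J H₁ H₂ : Type*} [NormedAddCommGroup H₁] [InnerProductSpace ℂ H₁] [CompleteSpace H₁]
  [NormedAddCommGroup H₂] [InnerProductSpace ℂ H₂] [CompleteSpace H₂]
  {ψ₁ : I → H₁} {ψ₂ : J → H₂} {w₁ : I → ℝ} {w₂ : J → ℝ}

theorem IsFrame.isFrame_tensorFrame (h₁ : IsFrame ψ₁) (h₂ : IsFrame ψ₂) :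
    IsFrame (tensorFrame ψ₁ ψ₂) := h₁.conj.tensor h₂

/-- The canonical dual of `ψ₁ ⊗ ψ₂` is `ψ₁~ ⊗ ψ₂~`, tested on simple tensors. -/
theorem IsFrame.inner_canonicalDual_tensorFrame (h₁ : IsFrame ψ₁) (h₂ : IsFrame ψ₂)
    (ij : I × J) (f : H₁) (g : H₂) :
    inner ℂ (canonicalDual (tensorFrame ψ₁ ψ₂) ij) (simpleTensor f g) =
      starRingEnd ℂ (inner ℂ (canonicalDual ψ₁ ij.1) f) * inner ℂ (canonicalDual ψ₂ ij.2) g := by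
  rw [(h₁.isFrame_tensorFrame h₂).inner_canonicalDual]
  have h := h₁.conj.frameInv_tensor h₂ (toConj f) g
  calc _ = inner ℂ (toConj (ψ₁ ij.1)) (h₁.conj.frameInv (toConj f)) *
        inner ℂ (ψ₂ ij.2) (h₂.frameInv g) := by
        refine (congrArg (inner ℂ (tensorFrame ψ₁ ψ₂ ij)) h).trans ?_
        rw [tensorFrame, simpleTensor, UniformSpace.Completion.inner_coe,
          TensorProduct.inner_tmul]
    _ = _ := by
        rw [← h₂.inner_canonicalDual, ← h₁.conj.inner_canonicalDual ij.1, h₁.canonicalDual_conj,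
          inner_toConj, inner_conj_symm]

theorem weightedCoeff_simpleTensor (h₁ : IsFrame ψ₁) (h₂ : IsFrame ψ₂) (f : H₁) (g : H₂)
    (ij : I × J) :
    weightedCoeff (tensorFrame ψ₁ ψ₂) (tensorWeight w₁ w₂) (simpleTensor f g) ij =
      starRingEnd ℂ (weightedCoeff ψ₁ w₁ f ij.1) * weightedCoeff ψ₂ w₂ g ij.2 := by
  rw [weightedCoeff_apply, h₁.inner_canonicalDual_tensorFrame h₂, weightedCoeff_apply,
    weightedCoeff_apply, map_mul, Complex.conj_ofReal, tensorWeight, Complex.ofReal_mul]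
  ring

/-- The co-orbit norm of a simple tensor is the product of the co-orbit norms. -/
theorem exists_norm_weightedCoeff_simpleTensor (h₁ : IsFrame ψ₁) (h₂ : IsFrame ψ₂)
    {f : H₁} {g : H₂} (hf : Memℓp (weightedCoeff ψ₁ w₁ f) 1)
    (hg : Memℓp (weightedCoeff ψ₂ w₂ g) 1) :
    ∃ h : Memℓp (weightedCoeff (tensorFrame ψ₁ ψ₂) (tensorWeight w₁ w₂) (simpleTensor f g)) 1,
      ‖(⟨_, h⟩ : lp (fun _ : I × J => ℂ) 1)‖ =
        ‖(⟨_, hf⟩ : lp (fun _ : I => ℂ) 1)‖ * ‖(⟨_, hg⟩ : lp (fun _ : J => ℂ) 1)‖ := by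
  have hf' := lp.hasSum_norm (p := 1) (by simp) (⟨_, hf⟩ : lp (fun _ : I => ℂ) 1)
  have hg' := lp.hasSum_norm (p := 1) (by simp) (⟨_, hg⟩ : lp (fun _ : J => ℂ) 1)
  simp only [ENNReal.toReal_one, Real.rpow_one] at hf' hg'
  have hsum := hf'.mul hg' (hf'.summable.mul_of_nonneg hg'.summable
    (fun _ => norm_nonneg _) fun _ => norm_nonneg _)
  have he (ij : I × J) :
      ‖weightedCoeff (tensorFrame ψ₁ ψ₂) (tensorWeight w₁ w₂) (simpleTensor f g) ij‖ =
        ‖weightedCoeff ψ₁ w₁ f ij.1‖ * ‖weightedCoeff ψ₂ w₂ g ij.2‖ := by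
    rw [weightedCoeff_simpleTensor h₁ h₂, norm_mul, RCLike.norm_conj]
  simp only [← he] at hsum
  have hmem : Memℓp (weightedCoeff (tensorFrame ψ₁ ψ₂) (tensorWeight w₁ w₂)
      (simpleTensor f g)) 1 := memℓp_gen (by simpa using hsum.summable)
  refine ⟨hmem, ?_⟩
  have h := lp.hasSum_norm (p := 1) (by simp) (⟨_, hmem⟩ : lp (fun _ : I × J => ℂ) 1)
  simp only [ENNReal.toReal_one, Real.rpow_one] at h
  exact h.unique hsum

theorem IsAtomic.tensor (h₁ : IsAtomic ψ₁ w₁) (h₂ : IsAtomic ψ₂ w₂) :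
    IsAtomic (tensorFrame ψ₁ ψ₂) (tensorWeight w₁ w₂) := by
  obtain ⟨K₁, hK₁, hb₁⟩ := h₁.exists_bound
  obtain ⟨K₂, hK₂, hb₂⟩ := h₂.exists_bound
  refine ⟨h₁.isFrame.isFrame_tensorFrame h₂.isFrame, fun ij => mul_pos (h₁.pos _) (h₂.pos _),
    K₁ * K₂, mul_nonneg hK₁ hK₂, fun ij => ?_⟩
  obtain ⟨hf, hf'⟩ := hb₁ ij.1
  obtain ⟨hg, hg'⟩ := hb₂ ij.2
  obtain ⟨h, hn⟩ := exists_norm_weightedCoeff_simpleTensor h₁.isFrame h₂.isFrame hf hg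
  refine ⟨h, hn.trans_le ?_⟩
  rw [tensorWeight, mul_mul_mul_comm]
  exact mul_le_mul hf' hg' (norm_nonneg _) (mul_nonneg hK₁ (h₁.pos _).le)

end TensorAtoms

/-! ### Continuous maps out of projective tensor products and co-orbit spaces -/

section Extension

variable {E G : Type*} [SeminormedAddCommGroup E] [NormedSpace ℂ E]
  [SeminormedAddCommGroup G] [NormedSpace ℂ G] [T0Space G] [CompleteSpace G]

/-- The extension of a bounded semilinear map to the completion. -/
def extendCompletion {σ : ℂ →+* ℂ} (T : E →SL[σ] G) : UniformSpace.Completion E →SL[σ] G :=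
  T.extend UniformSpace.Completion.toComplL

theorem extendCompletion_coe {σ : ℂ →+* ℂ} (T : E →SL[σ] G) (x : E) :
    extendCompletion T (x : UniformSpace.Completion E) = T x :=
  T.extend_eq (e := UniformSpace.Completion.toComplL) UniformSpace.Completion.denseRange_coe
    (UniformSpace.Completion.isUniformInducing_coe E) x

end Extension

section ProjectiveMaps

variable {E F G : Type*} [NormedAddCommGroup E] [NormedSpace ℂ E]
  [NormedAddCommGroup F] [NormedSpace ℂ F] [NormedAddCommGroup G] [NormedSpace ℂ G]

theorem ProjTensor.norm_tmul_le (x : E) (y : F) : ‖ProjTensor.tmul x y‖ ≤ ‖x‖ * ‖y‖ := by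
  rw [ProjTensor.tmul, UniformSpace.Completion.norm_coe]
  refine (PreProj.projNorm_le (l := [(x, y)]) (add_zero _)).trans (le_of_eq ?_)
  simp [PreProj.cost]

variable (E F) in
/-- The tensor product as a bounded bilinear map. -/
def ProjTensor.tmulL : E →L[ℂ] F →L[ℂ] ProjTensor E F :=
  LinearMap.mkContinuous₂ ((TensorProduct.mk ℂ E F : E →ₗ[ℂ] F →ₗ[ℂ] PreProj E F).compr₂
    (UniformSpace.Completion.toComplL (𝕜 := ℂ) (E := PreProj E F)).toLinearMap) 1 fun x y => by
      rw [one_mul]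
      exact ProjTensor.norm_tmul_le x y

/-- The linear map on the algebraic tensor product that is induced by a bilinear map. -/
def PreProj.lift (B : E →L[ℂ] F →L[ℂ] G) : PreProj E F →ₗ[ℂ] G :=
  TensorProduct.lift B.toLinearMap₁₂

theorem PreProj.lift_tmul (B : E →L[ℂ] F →L[ℂ] G) (x : E) (y : F) :
    PreProj.lift B (PreProj.tmul x y) = B x y := rfl

/-- A bounded bilinear map is bounded for the projective norm: the estimate holds for each
representation of a tensor. -/
theorem PreProj.norm_lift_le (B : E →L[ℂ] F →L[ℂ] G) (t : PreProj E F) :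
    ‖PreProj.lift B t‖ ≤ (‖B‖ + 1) * ‖t‖ := by
  have hpos : 0 < ‖B‖ + 1 := by positivity
  rw [← div_le_iff₀' hpos]
  refine PreProj.le_projNorm fun l hl => ?_
  rw [div_le_iff₀' hpos, ← hl]
  clear hl
  induction l with
  | nil =>
    rw [PreProj.sumTmul, PreProj.cost, List.map_nil, List.map_nil, List.sum_nil, List.sum_nil,
      map_zero, norm_zero, mul_zero]
  | cons q l ih =>
    rw [PreProj.sumTmul, PreProj.cost] at ih ⊢
    rw [List.map_cons, List.map_cons, List.sum_cons, List.sum_cons, map_add, mul_add,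
      PreProj.lift_tmul]
    refine norm_add_le_of_le ((B.le_opNorm₂ q.1 q.2).trans ?_) ih
    rw [mul_assoc]
    exact mul_le_mul_of_nonneg_right (by linarith) (by positivity)

/-- `PreProj.lift` as a bounded map. -/
def PreProj.liftL (B : E →L[ℂ] F →L[ℂ] G) : PreProj E F →L[ℂ] G :=
  LinearMap.mkContinuous (PreProj.lift B) (‖B‖ + 1) (PreProj.norm_lift_le B)

theorem ProjTensor.ext_tmul {S T : ProjTensor E F →L[ℂ] G}
    (h : ∀ x y, S (ProjTensor.tmul x y) = T (ProjTensor.tmul x y)) : S = T := by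
  ext t
  induction t using UniformSpace.Completion.induction_on with
  | hp => exact isClosed_eq S.continuous T.continuous
  | ih t =>
    refine TensorProduct.induction_on (motive := fun t : PreProj E F =>
      S (t : ProjTensor E F) = T (t : ProjTensor E F)) t ?_ h ?_
    · exact S.map_zero.trans T.map_zero.symm
    · intro s t hs ht
      refine (congrArg S (UniformSpace.Completion.coe_add (α := PreProj E F) s t)).trans
        (.trans ?_ (congrArg T (UniformSpace.Completion.coe_add (α := PreProj E F) s t)).symm)
      rw [map_add, map_add, hs, ht]

variable [CompleteSpace G]

/-- The bounded linear map on the projective tensor product that is induced by a bounded bilinear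
map. -/
def ProjTensor.liftL (B : E →L[ℂ] F →L[ℂ] G) : ProjTensor E F →L[ℂ] G :=
  extendCompletion (PreProj.liftL B)

theorem ProjTensor.liftL_tmul (B : E →L[ℂ] F →L[ℂ] G) (x : E) (y : F) :
    ProjTensor.liftL B (ProjTensor.tmul x y) = B x y :=
  extendCompletion_coe _ _

end ProjectiveMaps

section Synthesis

variable {I H X : Type*} [NormedAddCommGroup H] [InnerProductSpace ℂ H]
  [NormedAddCommGroup X] [NormedSpace ℂ X] [CompleteSpace X] {ψ : I → H} {w : I → ℝ}

/-- The map `f ↦ ∑_i ⟨f, ψ~_i⟩ a_i` for a family with `‖a_i‖ ≤ K w_i`. -/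
def IsAtomic.preSynthesis (h : IsAtomic ψ w) (a : I → X) {K : ℝ}
    (ha : ∀ i, ‖a i‖ ≤ K * w i) : PreCoorbit ψ w →L[ℂ] X :=
  LinearMap.mkContinuous
    { toFun := fun f => ∑' i, f.coeff i • a i
      map_add' := fun f g => by
        simp only [PreCoorbit.coeff_add, add_smul]
        exact (h.summable_norm_coeff_smul ha f).of_norm.tsum_add
          (h.summable_norm_coeff_smul ha g).of_norm
      map_smul' := fun z f => by
        simp only [PreCoorbit.coeff_smul, mul_smul]
        exact (h.summable_norm_coeff_smul ha f).of_norm.tsum_const_smul z } K fun f => by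
    refine tsum_of_norm_bounded ((h.hasSum_norm f).mul_left K) fun i => ?_
    rw [norm_smul, mul_left_comm]
    exact mul_le_mul_of_nonneg_left (ha i) (norm_nonneg _)

/-- The map `f ↦ ∑_i ⟨f, ψ~_i⟩ a_i` on the co-orbit space. -/
def IsAtomic.synthesis (h : IsAtomic ψ w) (a : I → X) {K : ℝ}
    (ha : ∀ i, ‖a i‖ ≤ K * w i) : Coorbit ψ w →L[ℂ] X :=
  extendCompletion (h.preSynthesis a ha)

theorem IsAtomic.hasSum_synthesis (h : IsAtomic ψ w) (a : I → X) {K : ℝ}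
    (ha : ∀ i, ‖a i‖ ≤ K * w i) (f : PreCoorbit ψ w) :
    HasSum (fun i => f.coeff i • a i) (h.synthesis a ha (f : Coorbit ψ w)) := by
  rw [synthesis, extendCompletion_coe]
  exact (h.summable_norm_coeff_smul ha f).of_norm.hasSum

end Synthesis

/-! ### The tensor product of two co-orbit spaces -/

section CoorbitTensor

variable {I J H₁ H₂ : Type*} [NormedAddCommGroup H₁] [InnerProductSpace ℂ H₁]
  [NormedAddCommGroup H₂] [InnerProductSpace ℂ H₂]

variable (H₁ H₂) in
/-- The simple tensor as a sesquilinear map. -/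
def simpleTensorₛₗ : H₁ →ₛₗ[starRingEnd ℂ] H₂ →ₗ[ℂ] HilbertTensor H₁ H₂ :=
  LinearMap.mk₂'ₛₗ (starRingEnd ℂ) (RingHom.id ℂ) simpleTensor
    (fun f f' g => by
      rw [simpleTensor, show toConj (f + f') = toConj f + toConj f' from rfl,
        TensorProduct.add_tmul, UniformSpace.Completion.coe_add]
      rfl)
    (fun z f g => by
      have : toConj (z • f) = starRingEnd ℂ z • toConj f := by
        rw [smul_toConj, Complex.conj_conj]
      rw [simpleTensor, this, ← TensorProduct.smul_tmul', UniformSpace.Completion.coe_smul]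
      rfl)
    (fun f g g' => by
      rw [simpleTensor, TensorProduct.tmul_add, UniformSpace.Completion.coe_add]
      rfl)
    (fun z f g => by
      rw [simpleTensor, TensorProduct.tmul_smul, UniformSpace.Completion.coe_smul]
      rfl)

variable {ψ₁ : I → H₁} {ψ₂ : J → H₂} {w₁ : I → ℝ} {w₂ : J → ℝ}

theorem simpleTensor_mem_H00 {f : H₁} {g : H₂} (hf : f ∈ H00 ψ₁) (hg : g ∈ H00 ψ₂) :
    simpleTensor f g ∈ H00 (tensorFrame ψ₁ ψ₂) := by
  have h1 (i : I) : H00 ψ₂ ≤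
      (H00 (tensorFrame ψ₁ ψ₂)).comap (simpleTensorₛₗ H₁ H₂ (ψ₁ i)) := by
    refine Submodule.span_le.2 ?_
    rintro _ ⟨j, rfl⟩
    exact Submodule.subset_span ⟨(i, j), rfl⟩
  have h2 : H00 ψ₁ ≤
      (H00 (tensorFrame ψ₁ ψ₂)).comap ((simpleTensorₛₗ H₁ H₂).flip g) := by
    refine Submodule.span_le.2 ?_
    rintro _ ⟨i, rfl⟩
    exact h1 i hg
  exact h2 hf

/-- The tensor products of the atoms in the projective tensor product. -/
def projAtom (h₁ : IsAtomic ψ₁ w₁) (h₂ : IsAtomic ψ₂ w₂) (ij : I × J) :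
    ProjTensor (Conj (Coorbit ψ₁ w₁)) (Coorbit ψ₂ w₂) :=
  ProjTensor.tmul (toConj (h₁.atom ij.1 : Coorbit ψ₁ w₁)) (h₂.atom ij.2 : Coorbit ψ₂ w₂)

theorem exists_norm_projAtom_le (h₁ : IsAtomic ψ₁ w₁) (h₂ : IsAtomic ψ₂ w₂) :
    ∃ K : ℝ, ∀ ij, ‖projAtom h₁ h₂ ij‖ ≤ K * tensorWeight w₁ w₂ ij := by
  obtain ⟨K₁, hK₁, hb₁⟩ := h₁.exists_norm_atom_le
  obtain ⟨K₂, hK₂, hb₂⟩ := h₂.exists_norm_atom_le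
  refine ⟨K₁ * K₂, fun ij => (ProjTensor.norm_tmul_le _ _).trans ?_⟩
  have e₁ : ‖toConj (h₁.atom ij.1 : Coorbit ψ₁ w₁)‖ = ‖h₁.atom ij.1‖ :=
    UniformSpace.Completion.norm_coe _
  have e₂ : ‖(h₂.atom ij.2 : Coorbit ψ₂ w₂)‖ = ‖h₂.atom ij.2‖ :=
    UniformSpace.Completion.norm_coe _
  rw [e₁, e₂, tensorWeight, mul_mul_mul_comm]
  exact mul_le_mul (hb₁ _) (hb₂ _) (norm_nonneg _) (mul_nonneg hK₁ (h₁.pos _).le)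

variable [CompleteSpace H₁] [CompleteSpace H₂]

/-- The simple tensor of two elements of the co-orbit spaces. -/
def PreCoorbit.tensor (h₁ : IsFrame ψ₁) (h₂ : IsFrame ψ₂) (f : PreCoorbit ψ₁ w₁)
    (g : PreCoorbit ψ₂ w₂) : PreCoorbit (tensorFrame ψ₁ ψ₂) (tensorWeight w₁ w₂) :=
  ⟨simpleTensor f.val g.val, simpleTensor_mem_H00 f.2.1 g.2.1,
    (exists_norm_weightedCoeff_simpleTensor h₁ h₂ f.2.2 g.2.2).1⟩

theorem PreCoorbit.norm_tensor (h₁ : IsFrame ψ₁) (h₂ : IsFrame ψ₂) (f : PreCoorbit ψ₁ w₁)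
    (g : PreCoorbit ψ₂ w₂) : ‖PreCoorbit.tensor h₁ h₂ f g‖ = ‖f‖ * ‖g‖ :=
  (exists_norm_weightedCoeff_simpleTensor h₁ h₂ f.2.2 g.2.2).2

theorem PreCoorbit.coeff_tensor (h₁ : IsFrame ψ₁) (h₂ : IsFrame ψ₂) (f : PreCoorbit ψ₁ w₁)
    (g : PreCoorbit ψ₂ w₂) (ij : I × J) : (PreCoorbit.tensor h₁ h₂ f g).coeff ij =
      starRingEnd ℂ (f.coeff ij.1) * g.coeff ij.2 :=
  h₁.inner_canonicalDual_tensorFrame h₂ ij f.val g.val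

/-- The simple tensor as a bounded sesquilinear map. -/
def preTensorL (w₁ : I → ℝ) (w₂ : J → ℝ) (h₁ : IsFrame ψ₁) (h₂ : IsFrame ψ₂) :
    PreCoorbit ψ₁ w₁ →SL[starRingEnd ℂ] PreCoorbit ψ₂ w₂ →L[ℂ] TensorCoorbit ψ₁ ψ₂ w₁ w₂ :=
  LinearMap.mkContinuous₂ (LinearMap.mk₂'ₛₗ (starRingEnd ℂ) (RingHom.id ℂ)
    (fun f g => (PreCoorbit.tensor h₁ h₂ f g : TensorCoorbit ψ₁ ψ₂ w₁ w₂))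
    (fun f f' g => by
      rw [← UniformSpace.Completion.coe_add]
      exact congrArg _ (Subtype.ext ((simpleTensorₛₗ H₁ H₂).map_add₂ f.val f'.val g.val)))
    (fun z f g => by
      rw [← UniformSpace.Completion.coe_smul]
      exact congrArg _ (Subtype.ext ((simpleTensorₛₗ H₁ H₂).map_smulₛₗ₂ z f.val g.val)))
    (fun f g g' => by
      rw [← UniformSpace.Completion.coe_add]
      exact congrArg _ (Subtype.ext ((simpleTensorₛₗ H₁ H₂ f.val).map_add g.val g'.val)))
    (fun z f g => by
      rw [← UniformSpace.Completion.coe_smul]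
      exact congrArg _ (Subtype.ext ((simpleTensorₛₗ H₁ H₂ f.val).map_smul z g.val)))) 1
    fun f g => by
      rw [one_mul]
      exact ((UniformSpace.Completion.norm_coe _).trans
        (PreCoorbit.norm_tensor h₁ h₂ f g)).le

/-- The extension of the simple tensor to the co-orbit spaces. -/
def coorbitTensorL (w₁ : I → ℝ) (w₂ : J → ℝ) (h₁ : IsFrame ψ₁) (h₂ : IsFrame ψ₂) :
    Coorbit ψ₁ w₁ →SL[starRingEnd ℂ] Coorbit ψ₂ w₂ →L[ℂ] TensorCoorbit ψ₁ ψ₂ w₁ w₂ :=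
  (extendCompletion (ContinuousLinearMap.flip (E := Coorbit ψ₁ w₁)
    (extendCompletion (preTensorL w₁ w₂ h₁ h₂)))).flip

theorem coorbitTensorL_coe (h₁ : IsFrame ψ₁) (h₂ : IsFrame ψ₂) (f : PreCoorbit ψ₁ w₁)
    (g : PreCoorbit ψ₂ w₂) :
    coorbitTensorL w₁ w₂ h₁ h₂ (f : Coorbit ψ₁ w₁) (g : Coorbit ψ₂ w₂) =
      (PreCoorbit.tensor h₁ h₂ f g : TensorCoorbit ψ₁ ψ₂ w₁ w₂) := by
  rw [coorbitTensorL, ContinuousLinearMap.flip_apply, extendCompletion_coe,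
    ContinuousLinearMap.flip_apply, extendCompletion_coe]
  rfl

/-- `coorbitTensorL` as a bilinear map on the conjugate of the first space. -/
def conjCoorbitTensorL (w₁ : I → ℝ) (w₂ : J → ℝ) (h₁ : IsFrame ψ₁) (h₂ : IsFrame ψ₂) :
    Conj (Coorbit ψ₁ w₁) →L[ℂ] Coorbit ψ₂ w₂ →L[ℂ] TensorCoorbit ψ₁ ψ₂ w₁ w₂ where
  toFun x := coorbitTensorL w₁ w₂ h₁ h₂ (ofConj x)
  map_add' x y := (coorbitTensorL w₁ w₂ h₁ h₂).map_add (ofConj x) (ofConj y)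
  map_smul' z x := ((coorbitTensorL w₁ w₂ h₁ h₂).map_smulₛₗ (starRingEnd ℂ z) (ofConj x)).trans
    (by rw [Complex.conj_conj]; rfl)
  cont := (coorbitTensorL w₁ w₂ h₁ h₂).continuous

/-- The canonical map from the projective tensor product to the co-orbit space of `ψ₁ ⊗ ψ₂`. -/
def projToCoorbit (w₁ : I → ℝ) (w₂ : J → ℝ) (h₁ : IsFrame ψ₁) (h₂ : IsFrame ψ₂) :
    ProjTensor (Conj (Coorbit ψ₁ w₁)) (Coorbit ψ₂ w₂) →L[ℂ] TensorCoorbit ψ₁ ψ₂ w₁ w₂ :=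
  ProjTensor.liftL (conjCoorbitTensorL w₁ w₂ h₁ h₂)

theorem projToCoorbit_tmul (h₁ : IsFrame ψ₁) (h₂ : IsFrame ψ₂) (f : PreCoorbit ψ₁ w₁)
    (g : PreCoorbit ψ₂ w₂) :
    projToCoorbit w₁ w₂ h₁ h₂
        (ProjTensor.tmul (toConj (f : Coorbit ψ₁ w₁)) (g : Coorbit ψ₂ w₂)) =
      (PreCoorbit.tensor h₁ h₂ f g : TensorCoorbit ψ₁ ψ₂ w₁ w₂) :=
  (ProjTensor.liftL_tmul _ _ _).trans (coorbitTensorL_coe h₁ h₂ f g)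

/-- The map `F ↦ ∑_{i,j} ⟨F, ψ₁~_i ⊗ ψ₂~_j⟩ ψ_{1,i} ⊗ ψ_{2,j}` from the co-orbit space of
`ψ₁ ⊗ ψ₂` to the projective tensor product. -/
def coorbitToProj (h₁ : IsAtomic ψ₁ w₁) (h₂ : IsAtomic ψ₂ w₂) :
    TensorCoorbit ψ₁ ψ₂ w₁ w₂ →L[ℂ] ProjTensor (Conj (Coorbit ψ₁ w₁)) (Coorbit ψ₂ w₂) :=
  (h₁.tensor h₂).synthesis (projAtom h₁ h₂) (exists_norm_projAtom_le h₁ h₂).choose_spec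

theorem projToCoorbit_coorbitToProj (h₁ : IsAtomic ψ₁ w₁) (h₂ : IsAtomic ψ₂ w₂)
    (F : TensorCoorbit ψ₁ ψ₂ w₁ w₂) :
    projToCoorbit w₁ w₂ h₁.isFrame h₂.isFrame (coorbitToProj h₁ h₂ F) = F := by
  induction F using UniformSpace.Completion.induction_on with
  | hp => exact isClosed_eq (by fun_prop) continuous_id
  | ih F =>
    have h := ((h₁.tensor h₂).hasSum_synthesis (projAtom h₁ h₂)
      (exists_norm_projAtom_le h₁ h₂).choose_spec F).mapL
      (projToCoorbit w₁ w₂ h₁.isFrame h₂.isFrame)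
    have h' := ((h₁.tensor h₂).hasSum_atom F).mapL
      (UniformSpace.Completion.toComplL (𝕜 := ℂ))
    simp only [map_smul, projAtom, projToCoorbit_tmul] at h h'
    exact h.unique h'

theorem coorbitToProj_projToCoorbit (h₁ : IsAtomic ψ₁ w₁) (h₂ : IsAtomic ψ₂ w₂)
    (T : ProjTensor (Conj (Coorbit ψ₁ w₁)) (Coorbit ψ₂ w₂)) :
    coorbitToProj h₁ h₂ (projToCoorbit w₁ w₂ h₁.isFrame h₂.isFrame T) = T := by
  let t := ProjTensor.tmulL (Conj (Coorbit ψ₁ w₁)) (Coorbit ψ₂ w₂)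
  suffices h : coorbitToProj h₁ h₂ ∘L projToCoorbit w₁ w₂ h₁.isFrame h₂.isFrame =
      ContinuousLinearMap.id ℂ _ from congr($h T)
  refine ProjTensor.ext_tmul fun x y => ?_
  have hcont : Continuous fun p : Coorbit ψ₁ w₁ × Coorbit ψ₂ w₂ =>
      ProjTensor.tmul (toConj p.1) p.2 :=
    t.continuous₂
  suffices h : ∀ (x : Coorbit ψ₁ w₁) (y : Coorbit ψ₂ w₂),
      coorbitToProj h₁ h₂ (projToCoorbit w₁ w₂ h₁.isFrame h₂.isFrame
        (ProjTensor.tmul (toConj x) y)) = ProjTensor.tmul (toConj x) y from h (ofConj x) y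
  intro x y
  induction x, y using UniformSpace.Completion.induction_on₂ with
  | hp => exact isClosed_eq (by fun_prop) hcont
  | ih f g =>
    rw [projToCoorbit_tmul]
    have h := (h₁.tensor h₂).hasSum_synthesis (projAtom h₁ h₂)
      (exists_norm_projAtom_le h₁ h₂).choose_spec (PreCoorbit.tensor h₁.isFrame h₂.isFrame f g)
    have hf : HasSum (fun i => toConj (f.coeff i • (h₁.atom i : Coorbit ψ₁ w₁)))
        (toConj (f : Coorbit ψ₁ w₁)) := by
      have := (h₁.hasSum_atom f).mapL (UniformSpace.Completion.toComplL (𝕜 := ℂ))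
      simp only [map_smul] at this
      exact this
    have hg : HasSum (fun j => g.coeff j • (h₂.atom j : Coorbit ψ₂ w₂))
        (g : Coorbit ψ₂ w₂) := by
      have := (h₂.hasSum_atom g).mapL (UniformSpace.Completion.toComplL (𝕜 := ℂ))
      simp only [map_smul] at this
      exact this
    have hfib (i : I) : HasSum (fun j =>
        (PreCoorbit.tensor h₁.isFrame h₂.isFrame f g).coeff (i, j) • projAtom h₁ h₂ (i, j))
        (t (toConj (f.coeff i • (h₁.atom i : Coorbit ψ₁ w₁))) (g : Coorbit ψ₂ w₂)) := by
      have := hg.mapL (t (toConj (f.coeff i • (h₁.atom i : Coorbit ψ₁ w₁))))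
      have hc : toConj (f.coeff i • (h₁.atom i : Coorbit ψ₁ w₁)) =
          starRingEnd ℂ (f.coeff i) • toConj (h₁.atom i : Coorbit ψ₁ w₁) := by
        rw [smul_toConj, Complex.conj_conj]
      simp only [PreCoorbit.coeff_tensor]
      rw [hc] at this ⊢
      simp only [map_smul, smul_apply, smul_smul] at this ⊢
      simp only [mul_comm (starRingEnd ℂ _)]
      exact this
    exact (h.prod_fiberwise hfib).unique (hf.mapL (t.flip (g : Coorbit ψ₂ w₂)))

/-- The co-orbit space of `ψ₁ ⊗ ψ₂` is the projective tensor product of the co-orbit spaces. -/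
def projEquivCoorbit (h₁ : IsAtomic ψ₁ w₁) (h₂ : IsAtomic ψ₂ w₂) :
    ProjTensor (Conj (Coorbit ψ₁ w₁)) (Coorbit ψ₂ w₂) ≃L[ℂ] TensorCoorbit ψ₁ ψ₂ w₁ w₂ :=
  ContinuousLinearEquiv.equivOfInverse (projToCoorbit w₁ w₂ h₁.isFrame h₂.isFrame)
    (coorbitToProj h₁ h₂) (coorbitToProj_projToCoorbit h₁ h₂) (projToCoorbit_coorbitToProj h₁ h₂)

end CoorbitTensor

/-- A linear homeomorphism changes the norm by at most a constant factor. -/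
theorem exists_norm_le_norm_equiv {E F : Type*} [NormedAddCommGroup E] [NormedSpace ℂ E]
    [NormedAddCommGroup F] [NormedSpace ℂ F] (Φ : E ≃L[ℂ] F) :
    ∃ C : ℝ, 1 ≤ C ∧ ∀ x, C⁻¹ * ‖x‖ ≤ ‖Φ x‖ ∧ ‖Φ x‖ ≤ C * ‖x‖ := by
  set S : E →L[ℂ] F := Φ.toContinuousLinearMap
  set T : F →L[ℂ] E := Φ.symm.toContinuousLinearMap
  have hS := norm_nonneg S
  have hT := norm_nonneg T
  refine ⟨1 + ‖S‖ + ‖T‖, by linarith, fun x => ⟨?_, ?_⟩⟩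
  · rw [inv_mul_le_iff₀ (by positivity)]
    have h : ‖Φ.symm (Φ x)‖ ≤ ‖T‖ * ‖Φ x‖ := T.le_opNorm (Φ x)
    rw [Φ.symm_apply_apply] at h
    nlinarith [norm_nonneg (Φ x)]
  · have h : ‖Φ x‖ ≤ ‖S‖ * ‖x‖ := S.le_opNorm x
    nlinarith [norm_nonneg x]

end LocalisedFrames

end

theorem mainTheorem3 {I J : Type*} [Countable I] [Countable J]
    {H₁ H₂ : Type*}
    [NormedAddCommGroup H₁] [InnerProductSpace ℂ H₁] [CompleteSpace H₁]
    [NormedAddCommGroup H₂] [InnerProductSpace ℂ H₂] [CompleteSpace H₂]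
    (𝒜₁ : SpectralMatrixAlgebra I) (𝒜₂ : SpectralMatrixAlgebra J)
    (ψ₁ : I → H₁) (ψ₂ : J → H₂) (w₁ : I → ℝ) (w₂ : J → ℝ)
    (hψ₁ : 𝒜₁.IsLocalised ψ₁) (hψ₂ : 𝒜₂.IsLocalised ψ₂)
    (hw₁ : 𝒜₁.IsAdmissible w₁) (hw₂ : 𝒜₂.IsAdmissible w₂) :
    -- the co-orbit norms are norms on the whole of `H_00`
    CoorbitNormWellDefined ψ₁ w₁ ∧ CoorbitNormWellDefined ψ₂ w₂ ∧
    CoorbitNormWellDefined (tensorFrame ψ₁ ψ₂) (tensorWeight w₁ w₂) ∧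
    -- the two spaces agree, simple tensors being identified with simple tensors
    ∃ Φ : ProjTensor (Conj (Coorbit ψ₁ w₁)) (Coorbit ψ₂ w₂) ≃L[ℂ] TensorCoorbit ψ₁ ψ₂ w₁ w₂,
      (∀ (f : PreCoorbit ψ₁ w₁) (g : PreCoorbit ψ₂ w₂),
        ∃ F : PreCoorbit (tensorFrame ψ₁ ψ₂) (tensorWeight w₁ w₂),
          F.val = simpleTensor f.val g.val ∧
          Φ (ProjTensor.tmul (toConj (f : Coorbit ψ₁ w₁)) (g : Coorbit ψ₂ w₂)) =
            (F : TensorCoorbit ψ₁ ψ₂ w₁ w₂)) ∧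
      ∃ C : ℝ, 1 ≤ C ∧ ∀ T : ProjTensor (Conj (Coorbit ψ₁ w₁)) (Coorbit ψ₂ w₂),
        C⁻¹ * ‖T‖ ≤ ‖Φ T‖ ∧ ‖Φ T‖ ≤ C * ‖T‖ := by
  have h₁ := hψ₁.isAtomic hw₁
  have h₂ := hψ₂.isAtomic hw₂
  exact ⟨h₁.coorbitNormWellDefined, h₂.coorbitNormWellDefined,
    (h₁.tensor h₂).coorbitNormWellDefined, projEquivCoorbit h₁ h₂,
    fun f g => ⟨PreCoorbit.tensor h₁.isFrame h₂.isFrame f g, rfl,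
      projToCoorbit_tmul h₁.isFrame h₂.isFrame f g⟩,
    exists_norm_le_norm_equiv _⟩
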